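/- A regular signed literal over variables $x_1,\dots,x_n$ with truth-value set $V=[0,1]$ is a triple $(x_j,\varrho,a)$ with $\varrho\in\{\le,\ge\}$ and $a\in[0,1]$; it stands for the condition $x_j\le a$ if $\varrho$ is $\le$, and for $x_j\ge 1-a$ if $\varrho$ is $\ge$. A 2-rSAT formula with $n$ variables and $m$ clauses is a list of $m$ clauses, each a disjunction of two such literals; it is satisfiable if values in $[0,1]$ can be assigned to the variables so that every clause contains a literal that holds. Let $F'_2(n,m,\infty)$ be the random formula whose $2m$ literals are independent, where in each literal the variable, the relation and the number $a$ are independent and uniform (on the $n$ variables, on $\{\le,\ge\}$, and on $[0,1]$). Let $F_2(n,m,\infty)$ be $F'_2(n,m,\infty)$ conditioned on the event that in every clause the two variables are distinct. **Theorem.** Let $c$ be a real constant and let $m=m(n)$ be natural numbers with $m(n)/n\to c$ as $n\to\infty$ (for example $m=\lfloor cn\rfloor$, $c \ge 0$). Then, as $n\to\infty$, both for $F=F_2(n,m(n),\infty)$ and for $F=F'_2(n,m(n),\infty)$: (a) if $c<2$, then $\Pr[F\text{ is satisfiable}]\to 1$ (asymptotically almost surely satisfiable); (b) if $c>2$, then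 $\Pr[F\text{ is satisfiable}]\to 0$ (asymptotically almost never satisfiable). -/

import Mathlib

open MeasureTheory ProbabilityTheory Filter Topology

namespace RegularSAT

/-- A regular signed literal over the variables `x_j`, `j : Fin n`, with truth values in `[0,1]`:
a triple (variable, comparison relation, threshold), where the relation `true` stands for `≤`
and `false` for `≥`. -/
abbrev Literal (n : ℕ) : Type := Fin n × Bool × unitInterval

/-- A clause is a row of `k` literals (a disjunction). -/
abbrev Clause (k n : ℕ) : Type := Fin k → Literal n

/-- A formula is a list of `m` clauses (a conjunction). -/
abbrev Formula (k n m : ℕ) : Type := Fin m → Clause k n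

/-- `(x_j, ≤, a)` is the condition `x_j ≤ a`, and `(x_j, ≥, a)` is the condition `x_j ≥ 1 - a`. -/
def Literal.Holds {n : ℕ} (x : Fin n → unitInterval) : Literal n → Prop
  | (j, true, a) => (x j : ℝ) ≤ a
  | (j, false, a) => 1 - (a : ℝ) ≤ x j

/-- There is an interpretation, with values in `[0,1]`, that makes at least one literal of every
clause true. -/
def Formula.Satisfiable {k n m : ℕ} (F : Formula k n m) : Prop :=
  ∃ x : Fin n → unitInterval, ∀ i : Fin m, ∃ s : Fin k, Literal.Holds x (F i s)

/-- In every clause, the variables in the `k` slots are distinct. -/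
def Formula.DistinctVars {k n m : ℕ} (F : Formula k n m) : Prop :=
  ∀ i : Fin m, Function.Injective fun s : Fin k => (F i s).1

/-- The law of a random literal: variable, relation and threshold are independent and uniform.
The threshold `1`, which gives a meaningless literal, has probability `0`. -/
noncomputable def literalLaw (n : ℕ) : Measure (Literal n) :=
  (uniformOn (Set.univ : Set (Fin n))).prod
    ((uniformOn (Set.univ : Set Bool)).prod (volume : Measure unitInterval))

/-- The random formula in which all `m * k` literals are drawn independently, so that
a variable can occur several times in the same clause. -/
noncomputable def formulaLawRep (k n m : ℕ) : Measure (Formula k n m) :=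
  Measure.pi fun _ : Fin m => Measure.pi fun _ : Fin k => literalLaw n

/-- The random formula in which the variables of each clause are distinct: the previous law
conditioned on this event. -/
noncomputable def formulaLaw (k n m : ℕ) : Measure (Formula k n m) :=
  (formulaLawRep k n m)[|{F | F.DistinctVars}]

end RegularSAT

/-! A clause is a pair of implications: if one of its literals fails, the other is forced. Two
literals conflict if they are on the same variable, with opposite relations and thresholds of sum
less than 1; for two random literals this has probability 1/(4n). A forced literal therefore
falsifies on average 2m/(4n) of the 2m literal occurrences, and each of these forces a new literal.
The forcing process has mean offspring c/2 and is critical at c = 2.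

Thresholds are first rounded to a grid with `q` cells, down (`e = 0`, harder to satisfy) for part
(a) and up (`e = 1`, easier) for part (b). Only upper bounds for probabilities of bad events are
needed, and these pass to the uniform law on finitely many grid formulas (`formulaLawRep_toGrid_le`)
and to the conditioned law (`tendsto_formulaLaw_zero`).

Part (a). If some extreme value of each variable does not lead to a contradiction by forcing, the
formula is satisfiable (`gridSat_of_no_closedWalks`). Otherwise both extreme values of one variable
are refuted, and the two refutations contain a bicycle on distinct clauses (`exists_bicycle`). A
bicycle has two more coincidences than a free chain, so a first moment bound gives O(1/n) times a
convergent geometric-type series of ratio (c/2)(1 + 1/q), up to a small margin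
(`prob_not_gridSat_le`).

Part (b). The clauses are used in three independent batches (`prob_gridSat_le`). A second moment
argument yields a variable such that each of its values forces a large constant number of seed
literals (`prob_forall_not_hit_le`, `exists_seeds`). From the seeds the supercritical forcing
process reaches linearly many literals; an exponential supermartingale in the total number of
conflicts bounds the probability of extinction (`listSum_failInd_le`). A clause whose two literals
both conflict with the forced ones then appears in the last batch (`prob_no_conflicting_clause_le`).
-/

namespace RegularSAT

/-! ### Uniform averages and probabilities on finite types. -/

/-- The average of a real function over a finite type. -/
noncomputable def avg {Ω : Type*} [Fintype Ω] (f : Ω → ℝ) : ℝ := (∑ ω, f ω) / Fintype.card Ω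

open Classical in
/-- The probability of an event under the uniform distribution on a finite type. -/
noncomputable def prob {Ω : Type*} [Fintype Ω] (S : Ω → Prop) : ℝ :=
  avg fun ω => if S ω then 1 else 0

section Avg

variable {Ω Ω' : Type*} [Fintype Ω] [Fintype Ω']

theorem avg_mono {f g : Ω → ℝ} (h : ∀ ω, f ω ≤ g ω) : avg f ≤ avg g := by
  unfold avg
  gcongr
  exact h _

theorem avg_add (f g : Ω → ℝ) : avg (fun ω => f ω + g ω) = avg f + avg g := by
  simp only [avg, Finset.sum_add_distrib, add_div]

theorem avg_sub (f g : Ω → ℝ) : avg (fun ω => f ω - g ω) = avg f - avg g := by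
  simp only [avg, Finset.sum_sub_distrib, sub_div]

theorem avg_mul_left (a : ℝ) (f : Ω → ℝ) : avg (fun ω => a * f ω) = a * avg f := by
  simp only [avg, ← Finset.mul_sum, mul_div_assoc]

theorem avg_const [Nonempty Ω] (a : ℝ) : avg (fun _ : Ω => a) = a := by
  simp [avg, Finset.card_univ]

theorem avg_sum {κ : Type*} (s : Finset κ) (f : κ → Ω → ℝ) :
    avg (fun ω => ∑ k ∈ s, f k ω) = ∑ k ∈ s, avg (f k) := by
  simp only [avg, Finset.sum_comm (s := Finset.univ), Finset.sum_div]

theorem avg_equiv (e : Ω ≃ Ω') (f : Ω' → ℝ) : avg (fun ω => f (e ω)) = avg f := by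
  simp only [avg, Fintype.card_congr e, e.sum_comp]

theorem avg_prod (f : Ω × Ω' → ℝ) : avg f = avg fun a => avg fun b => f (a, b) := by
  simp only [avg, Fintype.sum_prod_type, Fintype.card_prod, Nat.cast_mul, ← Finset.sum_div,
    div_div, mul_comm]

theorem avg_pi {γ Λ : Type*} [Fintype γ] [DecidableEq γ] [Fintype Λ] (f : γ → Λ → ℝ) :
    avg (fun ω : γ → Λ => ∏ g, f g (ω g)) = ∏ g, avg (f g) := by
  simp only [avg, Finset.prod_div_distrib, Finset.prod_univ_sum, Fintype.piFinset_univ,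
    Finset.prod_const, Fintype.card_fun, Nat.cast_pow, Finset.card_univ]

/-- Coordinates outside the range of `e` average out: any family of distinct positions of a uniform
random family is again uniform. -/
theorem avg_comp_injective {ι κ X : Type*} [Fintype ι] [Fintype κ] [Fintype X] [DecidableEq ι]
    [DecidableEq κ] [Nonempty X] {e : κ → ι} (he : Function.Injective e) (f : (κ → X) → ℝ) :
    avg (fun F : ι → X => f (F ∘ e)) = avg f := by
  classical
  have h1 := avg_equiv (Equiv.piEquivPiSubtypeProd (fun i => i ∈ Set.range e) (fun _ : ι => X))
    (fun P => f (fun k => P.1 ⟨e k, k, rfl⟩))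
  have h2 : (fun F : ι → X => f (F ∘ e)) = fun F : ι → X =>
      (fun P : ((i : {i // i ∈ Set.range e}) → X) × ((i : {i // i ∉ Set.range e}) → X) =>
        f (fun k => P.1 ⟨e k, k, rfl⟩))
        (Equiv.piEquivPiSubtypeProd (fun i => i ∈ Set.range e) (fun _ : ι => X) F) := by
    funext F
    rfl
  rw [h2, h1, avg_prod]
  simp only [avg_const]
  exact avg_equiv ((Equiv.ofInjective e he).symm.arrowCongr (Equiv.refl X)) f

theorem prob_nonneg (S : Ω → Prop) : 0 ≤ prob S := by
  unfold prob avg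
  positivity

theorem prob_mono {S T : Ω → Prop} (h : ∀ ω, S ω → T ω) : prob S ≤ prob T := by
  refine avg_mono fun ω => ?_
  by_cases hS : S ω
  · simp [hS, h ω hS]
  · simp only [hS, if_false]
    split_ifs <;> simp

theorem prob_or_le (S T : Ω → Prop) : prob (fun ω => S ω ∨ T ω) ≤ prob S + prob T := by
  unfold prob
  rw [← avg_add]
  refine avg_mono fun ω => ?_
  by_cases hS : S ω <;> by_cases hT : T ω <;> simp [hS, hT]

theorem prob_exists_le {κ : Type*} [Fintype κ] (S : κ → Ω → Prop) :
    prob (fun ω => ∃ k, S k ω) ≤ ∑ k, prob (S k) := by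
  classical
  unfold prob
  rw [← avg_sum]
  refine avg_mono fun ω => ?_
  split_ifs with h
  · obtain ⟨k, hk⟩ := h
    refine le_trans ?_ (Finset.single_le_sum (f := fun k => if S k ω then (1 : ℝ) else 0)
      (fun i _ => by positivity) (Finset.mem_univ k))
    simp [hk]
  · positivity

theorem prob_equiv (e : Ω ≃ Ω') (S : Ω' → Prop) : prob (fun ω => S (e ω)) = prob S := by
  classical
  unfold prob
  exact avg_equiv e fun ω => if S ω then 1 else 0

theorem prob_comp_injective {ι κ X : Type*} [Fintype ι] [Fintype κ] [Fintype X] [DecidableEq ι]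
    [DecidableEq κ] [Nonempty X] {e : κ → ι} (he : Function.Injective e) (S : (κ → X) → Prop) :
    prob (fun F : ι → X => S (F ∘ e)) = prob S := by
  unfold prob
  exact avg_comp_injective he fun F => open Classical in if S F then 1 else 0

theorem prob_le_one (S : Ω → Prop) : prob S ≤ 1 := by
  classical
  unfold prob avg
  refine div_le_one_of_le₀ ?_ (by positivity)
  rw [Finset.sum_boole]
  exact_mod_cast Finset.card_le_univ _

theorem prob_prod_le [Nonempty Ω] (S : Ω × Ω' → Prop) {ε : ℝ}
    (h : ∀ a, prob (fun b => S (a, b)) ≤ ε) : prob S ≤ ε := by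
  unfold prob
  rw [avg_prod]
  calc _ ≤ avg (fun _ : Ω => ε) := avg_mono h
    _ = ε := avg_const ε

theorem prob_fst [Nonempty Ω'] (S : Ω → Prop) :
    prob (fun a : Ω × Ω' => S a.1) = prob S := by
  unfold prob
  rw [avg_prod]
  exact congrArg avg (funext fun a => by classical exact avg_const (if S a then (1 : ℝ) else 0))

end Avg

/-! ### Grid literals, conflicts, and rounding of thresholds. -/

/-- A literal with one of `q` equally spaced thresholds. -/
abbrev GridLiteral (n q : ℕ) : Type := Fin n × Bool × Fin q

/-- A list of `m` binary clauses of grid literals. -/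
abbrev GridFormula (n q m : ℕ) : Type := Fin m → Fin 2 → GridLiteral n q

/-- The literal of index `i` has the threshold `(i + e) / q`. -/
def GridLiteral.Holds (e : ℕ) {n q : ℕ} (x : Fin n → unitInterval) : GridLiteral n q → Prop
  | (j, true, i) => (x j : ℝ) ≤ ((i : ℕ) + e : ℝ) / q
  | (j, false, i) => 1 - ((i : ℕ) + e : ℝ) / q ≤ x j

/-- Two grid literals that cannot hold at the same time. -/
def Conf (e : ℕ) {n q : ℕ} (l l' : GridLiteral n q) : Prop :=
  l.1 = l'.1 ∧ l.2.1 ≠ l'.2.1 ∧ (l.2.2 : ℕ) + l'.2.2 + 2 * e < q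

theorem Conf.symm {e n q : ℕ} {l l' : GridLiteral n q} (h : Conf e l l') : Conf e l' l :=
  ⟨h.1.symm, h.2.1.symm, by have := h.2.2; omega⟩

theorem Conf.not_holds {e n q : ℕ} {l l' : GridLiteral n q} (h : Conf e l l')
    {x : Fin n → unitInterval} (hl : l.Holds e x) : ¬ l'.Holds e x := by
  obtain ⟨j, b, i⟩ := l
  obtain ⟨j', b', i'⟩ := l'
  obtain ⟨h1, h2, h3⟩ := h
  simp only at h1 h2 h3
  subst h1
  have hq : (0 : ℝ) < q := by
    have : 0 < q := by omega
    exact_mod_cast this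
  have h4 : ((i : ℕ) + e : ℝ) / q + ((i' : ℕ) + e : ℝ) / q < 1 := by
    rw [← add_div, div_lt_one hq]
    have : ((i : ℕ) : ℝ) + (i' : ℕ) + 2 * e < q := by exact_mod_cast h3
    linarith
  intro hl'
  cases b <;> cases b' <;> simp only [GridLiteral.Holds, ne_eq, not_true_eq_false] at hl hl' h2 <;>
    linarith

/-- Satisfiability of a family of binary clauses of grid literals. -/
def GridSat (e : ℕ) {n q : ℕ} {ι : Type*} (G : ι → Fin 2 → GridLiteral n q) : Prop :=
  ∃ x : Fin n → unitInterval, ∀ i, ∃ s, (G i s).Holds e x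

section Cell

/-- The cell of the grid in which a threshold lies. -/
noncomputable def cell (q : ℕ) [NeZero q] (a : unitInterval) : Fin q :=
  -- The minimum matters only for a = 1, where the floor is `q`.
  ⟨min ⌊(a : ℝ) * q⌋₊ (q - 1), by have := NeZero.pos q; omega⟩

variable {q : ℕ} [NeZero q]

theorem cell_le (a : unitInterval) : ((cell q a : ℕ) : ℝ) / q ≤ a := by
  have hq : (0 : ℝ) < q := by exact_mod_cast NeZero.pos q
  rw [div_le_iff₀ hq]
  have h0 : 0 ≤ (a : ℝ) * q := mul_nonneg a.2.1 hq.le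
  refine le_trans ?_ (Nat.floor_le h0)
  exact_mod_cast min_le_left _ _

theorem le_cell (a : unitInterval) : (a : ℝ) ≤ ((cell q a : ℕ) + 1 : ℝ) / q := by
  have hq : (0 : ℝ) < q := by exact_mod_cast NeZero.pos q
  rw [le_div_iff₀ hq]
  have h1 : (a : ℝ) * q ≤ q := by nlinarith [a.2.2]
  rcases min_choice ⌊(a : ℝ) * q⌋₊ (q - 1) with h | h
  · have := (Nat.lt_floor_add_one ((a : ℝ) * q)).le
    simpa only [cell, h] using this
  · simp only [cell, h]
    have : ((q - 1 : ℕ) : ℝ) + 1 = q := by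
      have := NeZero.pos q
      exact_mod_cast Nat.sub_add_cancel this
    linarith

theorem volume_cell_le (i : Fin q) :
    (volume : Measure unitInterval) {a | cell q a = i} ≤ ENNReal.ofReal (1 / q) := by
  have hq : (0 : ℝ) < q := by exact_mod_cast NeZero.pos q
  have h1 : (volume : Measure unitInterval) {a | cell q a = i}
      ≤ (volume : Measure ℝ) (Set.Icc ((i : ℕ) / q : ℝ) (((i : ℕ) + 1 : ℝ) / q)) := by
    rw [unitInterval.volume_apply]
    refine measure_mono ?_
    rintro _ ⟨a, rfl, rfl⟩
    exact ⟨cell_le a, le_cell a⟩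
  refine h1.trans ?_
  rw [Real.volume_Icc, ← sub_div, add_sub_cancel_left]

/-- Rounding of the threshold of a literal. -/
noncomputable def toGrid (q : ℕ) [NeZero q] {n : ℕ} (l : Literal n) : GridLiteral n q :=
  (l.1, l.2.1, cell q l.2.2)

theorem holds_of_toGrid_holds {n : ℕ} {x : Fin n → unitInterval} {l : Literal n}
    (h : (toGrid q l).Holds 0 x) : l.Holds x := by
  obtain ⟨j, b, a⟩ := l
  have := cell_le (q := q) a
  cases b <;> simp only [toGrid, GridLiteral.Holds, Literal.Holds, Nat.cast_zero, add_zero] at h ⊢ <;>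
    linarith

theorem toGrid_holds_of_holds {n : ℕ} {x : Fin n → unitInterval} {l : Literal n}
    (h : l.Holds x) : (toGrid q l).Holds 1 x := by
  obtain ⟨j, b, a⟩ := l
  have := le_cell (q := q) a
  cases b <;> simp only [toGrid, GridLiteral.Holds, Literal.Holds, Nat.cast_one] at h ⊢ <;>
    linarith

end Cell

/-! ### From the continuous law to the uniform law on grid formulas. -/

section Transfer

variable {n q : ℕ} [NeZero q]

theorem uniformOn_univ_singleton {α : Type*} [Fintype α] [MeasurableSpace α]
    [MeasurableSingletonClass α] (a : α) :
    uniformOn (Set.univ : Set α) {a} = (Fintype.card α : ENNReal)⁻¹ := by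
  rw [uniformOn_univ]
  simp

theorem literalLaw_toGrid_le (l : GridLiteral n q) :
    literalLaw n {l' | toGrid q l' = l} ≤ (Fintype.card (GridLiteral n q) : ENNReal)⁻¹ := by
  obtain ⟨j, b, i⟩ := l
  have h : {l' : Literal n | toGrid q l' = (j, b, i)} = {j} ×ˢ ({b} ×ˢ {a | cell q a = i}) := by
    ext ⟨j', b', a'⟩
    simp [toGrid]
  rw [h, literalLaw, Measure.prod_prod, Measure.prod_prod, uniformOn_univ_singleton,
    uniformOn_univ_singleton]
  calc _ ≤ (Fintype.card (Fin n) : ENNReal)⁻¹ * ((Fintype.card Bool : ENNReal)⁻¹ *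
      ENNReal.ofReal (1 / q)) := by
        gcongr
        exact volume_cell_le i
    _ = _ := by
      have hq : (0 : ℝ) < q := by exact_mod_cast NeZero.pos q
      simp only [Fintype.card_prod, Nat.cast_mul, one_div]
      rw [ENNReal.ofReal_inv_of_pos hq, ENNReal.ofReal_natCast, Fintype.card_fin, Fintype.card_fin,
        ENNReal.mul_inv, ENNReal.mul_inv] <;> simp [ENNReal.mul_eq_top]

instance isProbabilityMeasure_literalLaw (n : ℕ) [NeZero n] :
    IsProbabilityMeasure (literalLaw n) := by
  unfold literalLaw
  have : IsProbabilityMeasure (uniformOn (Set.univ : Set (Fin n))) :=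
    isProbabilityMeasure_uniformOn Set.finite_univ Set.univ_nonempty
  have : IsProbabilityMeasure (uniformOn (Set.univ : Set Bool)) :=
    isProbabilityMeasure_uniformOn Set.finite_univ Set.univ_nonempty
  infer_instance

instance isProbabilityMeasure_formulaLawRep (k n m : ℕ) [NeZero n] :
    IsProbabilityMeasure (formulaLawRep k n m) := by
  unfold formulaLawRep
  infer_instance

/-- The event is covered by the boxes of the grid formulas in `S`, and each box has at most its
uniform mass. An inequality suffices, since it is applied only to bad events, and it requires no
measurability. -/
theorem formulaLawRep_toGrid_le [NeZero n] {m : ℕ} (S : GridFormula n q m → Prop) :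
    formulaLawRep 2 n m {F | S fun i s => toGrid q (F i s)} ≤ ENNReal.ofReal (prob S) := by
  classical
  set N : ℕ := Fintype.card (GridLiteral n q) with hN
  have hN0 : 0 < N := Fintype.card_pos
  have h1 : {F : Formula 2 n m | S fun i s => toGrid q (F i s)} ⊆
      ⋃ G ∈ Finset.univ.filter S, Set.univ.pi fun i => Set.univ.pi fun s =>
        {l : Literal n | toGrid q l = G i s} := by
    intro F hF
    simp only [Set.mem_iUnion]
    exact ⟨_, by simpa using hF, fun i _ s _ => rfl⟩
  have h2 : ∀ G : GridFormula n q m, formulaLawRep 2 n m (Set.univ.pi fun i => Set.univ.pi fun s =>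
        {l : Literal n | toGrid q l = G i s}) ≤ ((N : ENNReal)⁻¹ ^ 2) ^ m := by
    intro G
    unfold formulaLawRep
    rw [Measure.pi_pi]
    simp only [Measure.pi_pi]
    calc _ ≤ ∏ _i : Fin m, ∏ _s : Fin 2, (N : ENNReal)⁻¹ := by
          gcongr
          exact literalLaw_toGrid_le _
      _ = _ := by simp
  refine (measure_mono h1).trans ((measure_biUnion_finset_le _ _).trans
    ((Finset.sum_le_sum fun G _ => h2 G).trans ?_))
  have h3 : prob S = ((Finset.univ.filter S).card : ℝ) * (((N : ℝ)⁻¹ ^ 2) ^ m) := by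
    rw [prob, avg]
    rw [div_eq_mul_inv]
    congr 1
    · rw [Finset.sum_boole]
    · simp only [Fintype.card_fun, Fintype.card_fin, Nat.cast_pow, hN, inv_pow]
  rw [h3, ENNReal.ofReal_mul (by positivity), ENNReal.ofReal_natCast, ENNReal.ofReal_pow
    (by positivity), ENNReal.ofReal_pow (by positivity), ENNReal.ofReal_inv_of_pos
    (by exact_mod_cast hN0), ENNReal.ofReal_natCast, Finset.sum_const, nsmul_eq_mul]

end Transfer

/-! ### Conditioning on distinct variables within each clause. -/

section Conditioning

theorem clauseLaw_eq_vars_le (n : ℕ) [NeZero n] :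
    (Measure.pi fun _ : Fin 2 => literalLaw n) {C | (C 0).1 = (C 1).1} ≤ (n : ENNReal)⁻¹ := by
  have h1 : {C : Clause 2 n | (C 0).1 = (C 1).1} ⊆
      ⋃ j : Fin n, Set.univ.pi fun _ => {l : Literal n | l.1 = j} := by
    intro C hC
    simp only [Set.mem_iUnion]
    refine ⟨(C 0).1, fun s _ => ?_⟩
    fin_cases s
    · rfl
    · exact hC.symm
  have h2 : ∀ j : Fin n, literalLaw n {l | l.1 = j} = (n : ENNReal)⁻¹ := by
    intro j
    have h : {l : Literal n | l.1 = j} = {j} ×ˢ Set.univ := by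
      ext l
      simp [Set.mem_prod]
    have : IsProbabilityMeasure (uniformOn (Set.univ : Set Bool)) :=
      isProbabilityMeasure_uniformOn Set.finite_univ Set.univ_nonempty
    rw [h, literalLaw, Measure.prod_prod, uniformOn_univ_singleton, measure_univ, mul_one,
      Fintype.card_fin]
  refine (measure_mono h1).trans ((measure_iUnion_fintype_le _ _).trans ?_)
  have hn : (n : ENNReal) ≠ 0 := by simp [NeZero.ne n]
  simp only [Measure.pi_pi, h2, Finset.prod_const, Finset.card_univ, Fintype.card_fin,
    Finset.sum_const, nsmul_eq_mul]
  rw [pow_two, ← mul_assoc, ENNReal.mul_inv_cancel hn (by simp), one_mul]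

theorem le_formulaLawRep_distinctVars (n m : ℕ) [NeZero n] :
    (1 - (n : ENNReal)⁻¹) ^ m ≤ formulaLawRep 2 n m {F | F.DistinctVars} := by
  have h : {F : Formula 2 n m | F.DistinctVars} =
      Set.univ.pi fun _ => {C : Clause 2 n | (C 0).1 = (C 1).1}ᶜ := by
    ext F
    simp only [Formula.DistinctVars, Set.mem_ofPred_eq, Set.mem_univ_pi, Set.mem_compl_iff]
    refine forall_congr' fun i => ⟨fun h h' => by simpa using h h', fun h s s' hs => ?_⟩
    fin_cases s <;> fin_cases s' <;> first | rfl | exact absurd hs h | exact absurd hs.symm h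
  rw [h, formulaLawRep, Measure.pi_pi, Finset.prod_const, Finset.card_univ, Fintype.card_fin]
  gcongr
  refine tsub_le_iff_right.2 ?_
  rw [← measure_univ (μ := Measure.pi fun _ : Fin 2 => literalLaw n)]
  refine (measure_mono (Set.compl_union_self {C : Clause 2 n | (C 0).1 = (C 1).1}).ge).trans
    ((measure_union_le _ _).trans ?_)
  gcongr
  exact clauseLaw_eq_vars_le n

theorem measurableSet_distinctVars (n m : ℕ) :
    MeasurableSet {F : Formula 2 n m | F.DistinctVars} := by
  have h : {F : Formula 2 n m | F.DistinctVars} =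
      ⋂ i, (fun F : Formula 2 n m => ((F i 0).1, (F i 1).1)) ⁻¹' {p | p.1 ≠ p.2} := by
    ext F
    simp only [Formula.DistinctVars, Set.mem_ofPred_eq, Set.mem_iInter, Set.mem_preimage]
    refine forall_congr' fun i => ⟨fun h h' => by simpa using h h', fun h s s' hs => ?_⟩
    fin_cases s <;> fin_cases s' <;> first | rfl | exact absurd hs h | exact absurd hs.symm h
  rw [h]
  refine MeasurableSet.iInter fun i => ?_
  have : Measurable (fun F : Formula 2 n m => ((F i 0).1, (F i 1).1)) := by fun_prop
  exact this (Set.toFinite _).measurableSet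

theorem formulaLaw_le (n m : ℕ) [NeZero n] (S : Set (Formula 2 n m)) :
    formulaLaw 2 n m S ≤ ((1 - (n : ENNReal)⁻¹) ^ m)⁻¹ * formulaLawRep 2 n m S := by
  rw [formulaLaw, cond_apply (measurableSet_distinctVars n m)]
  gcongr
  · exact le_formulaLawRep_distinctVars n m
  · exact Set.inter_subset_right

theorem isProbabilityMeasure_formulaLaw (n m : ℕ) (hn : 2 ≤ n) :
    IsProbabilityMeasure (formulaLaw 2 n m) := by
  have : NeZero n := ⟨by omega⟩
  refine cond_isProbabilityMeasure (ne_of_gt ?_)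
  refine lt_of_lt_of_le ?_ (le_formulaLawRep_distinctVars n m)
  refine ENNReal.pow_pos (tsub_pos_of_lt ?_) m
  rw [ENNReal.inv_lt_one]
  exact_mod_cast hn

theorem inv_one_sub_inv_pow_le (n m : ℕ) (hn : 2 ≤ n) :
    ((1 - (n : ENNReal)⁻¹) ^ m)⁻¹ ≤ ENNReal.ofReal (Real.exp (2 * (m / n))) := by
  have hn0 : (0 : ℝ) < n := by positivity
  have hn2 : (2 : ℝ) ≤ n := by exact_mod_cast hn
  have h1 : (1 - (n : ENNReal)⁻¹) = ENNReal.ofReal (1 - (n : ℝ)⁻¹) := by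
    rw [ENNReal.ofReal_sub _ (by positivity), ENNReal.ofReal_one, ENNReal.ofReal_inv_of_pos hn0,
      ENNReal.ofReal_natCast]
  have h2 : (0 : ℝ) < 1 - (n : ℝ)⁻¹ := by
    rw [sub_pos]
    exact inv_lt_one_of_one_lt₀ (by linarith)
  rw [h1, ← ENNReal.ofReal_pow h2.le, ← ENNReal.ofReal_inv_of_pos (by positivity), ← inv_pow]
  refine ENNReal.ofReal_le_ofReal ?_
  have h3 : (1 - (n : ℝ)⁻¹)⁻¹ ≤ Real.exp (2 / n) := by
    have h4 : (1 - (n : ℝ)⁻¹)⁻¹ ≤ 2 / n + 1 := by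
      rw [inv_le_iff_one_le_mul₀ h2]
      have h5 : (0 : ℝ) ≤ 1 - 2 / n := by
        rw [sub_nonneg, div_le_one hn0]
        exact hn2
      have h6 : (2 / n + 1) * (1 - (n : ℝ)⁻¹) = 1 + (n : ℝ)⁻¹ * (1 - 2 / n) := by
        field_simp
        ring
      rw [h6]
      have := mul_nonneg (inv_nonneg.2 hn0.le) h5
      linarith
    exact h4.trans (Real.add_one_le_exp _)
  calc (1 - (n : ℝ)⁻¹)⁻¹ ^ m ≤ Real.exp (2 / n) ^ m := by gcongr
    _ = Real.exp (2 * (m / n)) := by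
      rw [← Real.exp_nat_mul]
      congr 1
      ring

/-- Conditioning multiplies a probability by at most the inverse of that of the condition, here at
most exp(2m/n), which stays bounded because m = O(n). -/
theorem tendsto_formulaLaw_zero {c : ℝ} {m : ℕ → ℕ}
    (hm : Tendsto (fun n : ℕ => (m n : ℝ) / (n : ℝ)) atTop (𝓝 c))
    (S : ∀ n, Set (Formula 2 n (m n)))
    (hS : Tendsto (fun n => formulaLawRep 2 n (m n) (S n)) atTop (𝓝 0)) :
    Tendsto (fun n => formulaLaw 2 n (m n) (S n)) atTop (𝓝 0) := by
  have h1 : Tendsto (fun n => ENNReal.ofReal (Real.exp (2 * (c + 1))) *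
      formulaLawRep 2 n (m n) (S n)) atTop (𝓝 0) := by
    simpa using ENNReal.Tendsto.const_mul hS (Or.inr ENNReal.ofReal_ne_top)
  refine tendsto_of_tendsto_of_tendsto_of_le_of_le' tendsto_const_nhds h1
    (Eventually.of_forall fun _ => zero_le) ?_
  filter_upwards [eventually_ge_atTop 2, hm.eventually_le_const (lt_add_one c)] with n hn hmn
  have : NeZero n := ⟨by omega⟩
  refine (formulaLaw_le n (m n) (S n)).trans ?_
  gcongr
  exact (inv_one_sub_inv_pow_le n (m n) hn).trans (by gcongr)

/-- Subadditivity alone is used, so the sets, here those of satisfiable formulas, need not be shown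
measurable. -/
theorem tendsto_measure_one {Ω : ℕ → Type*} [∀ n, MeasurableSpace (Ω n)]
    (μ : ∀ n, Measure (Ω n)) (hμ : ∀ᶠ n in atTop, IsProbabilityMeasure (μ n))
    (S : ∀ n, Set (Ω n)) (hS : Tendsto (fun n => μ n (S n)ᶜ) atTop (𝓝 0)) :
    Tendsto (fun n => μ n (S n)) atTop (𝓝 1) := by
  have h1 : Tendsto (fun n => 1 - μ n (S n)ᶜ) atTop (𝓝 1) := by
    simpa using ENNReal.Tendsto.sub tendsto_const_nhds hS (Or.inl ENNReal.one_ne_top)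
  refine tendsto_of_tendsto_of_tendsto_of_le_of_le' h1 tendsto_const_nhds ?_ ?_
  · filter_upwards [hμ] with n hn
    refine tsub_le_iff_right.2 ?_
    rw [← measure_univ (μ := μ n)]
    exact (measure_mono (Set.union_compl_self (S n)).ge).trans (measure_union_le _ _)
  · filter_upwards [hμ] with n hn
    exact MeasureTheory.prob_le_one

end Conditioning


/-! ### Implication chains, satisfiability without refutations, and bicycles. -/

section Walks

variable {n q m : ℕ}

/-- The literal that has to fail for the occurrence to force the other literal of its clause. -/
def prem (G : GridFormula n q m) (o : Fin m × Fin 2) : GridLiteral n q := G o.1 o.2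

/-- The literal forced by the failure of `prem G o`. -/
def concl (G : GridFormula n q m) (o : Fin m × Fin 2) : GridLiteral n q := G o.1 (o.2 + 1)

/-- The same clause, used in the opposite direction. -/
def turn (o : Fin m × Fin 2) : Fin m × Fin 2 := (o.1, o.2 + 1)

theorem prem_turn (G : GridFormula n q m) (o : Fin m × Fin 2) : prem G (turn o) = concl G o := rfl

theorem concl_turn (G : GridFormula n q m) (o : Fin m × Fin 2) : concl G (turn o) = prem G o := by
  have h : ∀ s : Fin 2, s + 1 + 1 = s := by decide
  simp only [concl, turn, prem, h]

/-- The literal forced by `o` makes the premise of `o'` fail. -/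
def Step (G : GridFormula n q m) (o o' : Fin m × Fin 2) : Prop := Conf 0 (concl G o) (prem G o')

/-- A chain of forced literals that leads from `u` to a literal in conflict with `u`. -/
def ClosedWalk (G : GridFormula n q m) (u : GridLiteral n q) (r : ℕ) (o : ℕ → Fin m × Fin 2) :
    Prop :=
  Conf 0 u (prem G (o 0)) ∧ (∀ t < r, Step G (o t) (o (t + 1))) ∧ Conf 0 (concl G (o r)) u

theorem exists_closedWalk_of_reflTransGen {G : GridFormula n q m} {u : GridLiteral n q}
    {o₁ o₂ : Fin m × Fin 2} (h : Relation.ReflTransGen (Step G) o₁ o₂)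
    (h₁ : Conf 0 u (prem G o₁)) (h₂ : Conf 0 (concl G o₂) u) : ∃ r o, ClosedWalk G u r o := by
  suffices h' : ∃ (r : ℕ) (o : ℕ → Fin m × Fin 2), o 0 = o₁ ∧ o r = o₂ ∧
      ∀ t < r, Step G (o t) (o (t + 1)) by
    obtain ⟨r, o, h0, hr, hs⟩ := h'
    exact ⟨r, o, by rwa [h0], hs, by rwa [hr]⟩
  clear h₁ h₂
  induction h using Relation.ReflTransGen.head_induction_on with
  | refl => exact ⟨0, fun _ => o₂, rfl, rfl, by simp⟩
  | @head a b h _ ih =>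
    obtain ⟨r, o, h0, hr, hs⟩ := ih
    refine ⟨r + 1, fun t => Nat.casesOn t a o, rfl, hr, fun t ht => ?_⟩
    cases t with
    | zero => simpa [h0] using h
    | succ t => exact hs t (by omega)

/-- Contraposition: each clause is an implication in both directions and `Conf` is symmetric. -/
theorem reflTransGen_turn {G : GridFormula n q m} {o₁ o₂ : Fin m × Fin 2}
    (h : Relation.ReflTransGen (Step G) o₁ o₂) :
    Relation.ReflTransGen (Step G) (turn o₂) (turn o₁) := by
  induction h with
  | refl => exact .refl
  | tail _ h ih =>
    refine .head ?_ ih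
    unfold Step
    rw [concl_turn, prem_turn]
    exact Conf.symm h

theorem conf_extreme [NeZero q] {j : Fin n} {σ : Bool} {l : GridLiteral n q} :
    Conf 0 (j, σ, 0) l ↔ l.1 = j ∧ l.2.1 ≠ σ := by
  have := l.2.2.2
  simp only [Conf, Fin.val_zero, zero_add, mul_zero, add_zero, this, and_true]
  exact ⟨fun h => ⟨h.1.symm, h.2.symm⟩, fun h => ⟨h.1.symm, h.2.symm⟩⟩

/-- The analogue of unit propagation for 2-SAT. A non-contradictory extreme value is given to a
variable of a remaining clause, and everything it forces is accepted. The accepted set is closed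
under forcing, so a clause not yet satisfied has no literal in conflict with it, and the induction
continues on those clauses alone. -/
theorem exists_nonconflicting [NeZero q] (G : GridFormula n q m)
    (hG : ∀ j : Fin n, ∃ σ, ∀ r o, ¬ ClosedWalk G (j, σ, 0) r o) (I : Finset (Fin m)) :
    ∃ S : Set (GridLiteral n q), (∀ l ∈ S, ∀ l' ∈ S, ¬ Conf 0 l l') ∧ ∀ i ∈ I, ∃ s, G i s ∈ S := by
  classical
  induction I using Finset.strongInduction with
  | H I ih =>
    rcases I.eq_empty_or_nonempty with rfl | ⟨i₀, hi₀⟩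
    · exact ⟨∅, by simp, by simp⟩
    obtain ⟨σ, hσ⟩ := hG (G i₀ 0).1
    set j := (G i₀ 0).1 with hj
    have hno : ∀ {o₁ o₂ : Fin m × Fin 2}, Relation.ReflTransGen (Step G) o₁ o₂ →
        Conf 0 (j, σ, 0) (prem G o₁) → ¬ Conf 0 (concl G o₂) (j, σ, 0) := by
      intro o₁ o₂ h h₁ h₂
      obtain ⟨r, o, h⟩ := exists_closedWalk_of_reflTransGen h h₁ h₂
      exact hσ r o h
    set U : Set (GridLiteral n q) := {l | l.1 = j ∧ l.2.1 = σ} with hU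
    set R : Set (GridLiteral n q) := {l | ∃ o₁ o, Conf 0 (j, σ, 0) (prem G o₁) ∧
      Relation.ReflTransGen (Step G) o₁ o ∧ l = concl G o} with hR
    have hUR : ∀ l ∈ U, ∀ l' ∈ R, ¬ Conf 0 l l' := by
      rintro l ⟨hl, hl2⟩ _ ⟨o₁, o, h₁, h, rfl⟩ hc
      refine hno h h₁ (Conf.symm (conf_extreme.2 ⟨hc.1.symm.trans hl, ?_⟩))
      rw [← hl2]
      exact hc.2.1.symm
    have hT : ∀ l ∈ U ∪ R, ∀ l' ∈ U ∪ R, ¬ Conf 0 l l' := by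
      rintro l (hl | hl) l' (hl' | hl')
      · intro hc
        exact hc.2.1 (hl.2.trans hl'.2.symm)
      · exact hUR l hl l' hl'
      · exact fun hc => hUR l' hl' l hl hc.symm
      -- If two forced literals conflict, the first chain followed by the contrapositive of the
      -- second is a closed walk.
      · obtain ⟨o₁, o, h₁, h, rfl⟩ := hl
        obtain ⟨o₁', o', h₁', h', rfl⟩ := hl'
        intro hc
        refine hno (h.trans (.head ?_ (reflTransGen_turn h'))) h₁ ?_
        · exact hc
        · rw [concl_turn]
          exact h₁'.symm
    have hclosed : ∀ l ∈ U ∪ R, ∀ o, Conf 0 l (prem G o) → concl G o ∈ U ∪ R := by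
      rintro l (hl | ⟨o₁, o', h₁, h, rfl⟩) o hc
      · refine Or.inr ⟨o, o, conf_extreme.2 ⟨hc.1.symm.trans hl.1, ?_⟩, .refl, rfl⟩
        rw [← hl.2]
        exact hc.2.1.symm
      · exact Or.inr ⟨o₁, o, h₁, h.tail hc, rfl⟩
    set I' := I.filter fun i => ∀ s, G i s ∉ U ∪ R with hI'
    have hlt : I' ⊂ I := by
      refine Finset.filter_ssubset.2 ⟨i₀, hi₀, fun h => ?_⟩
      by_cases hs : (G i₀ 0).2.1 = σ
      · exact h 0 (Or.inl ⟨rfl, hs⟩)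
      · exact h 1 (Or.inr ⟨(i₀, 0), (i₀, 0), conf_extreme.2 ⟨rfl, hs⟩, .refl, rfl⟩)
    obtain ⟨S', hS', hS'I⟩ := ih I' hlt
    -- `S'` is restricted to literals that occur in the remaining clauses: a conflict with one of
    -- them would force the other literal of its clause into `U ∪ R`.
    have hTS : ∀ l ∈ U ∪ R, ∀ l' ∈ {l | l ∈ S' ∧ ∃ i ∈ I', ∃ s, l = G i s}, ¬ Conf 0 l l' := by
      rintro l hl _ ⟨-, i, hi, s, rfl⟩ hc
      exact (Finset.mem_filter.1 hi).2 (s + 1) (hclosed l hl (i, s) hc)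
    refine ⟨(U ∪ R) ∪ {l | l ∈ S' ∧ ∃ i ∈ I', ∃ s, l = G i s}, ?_, fun i hi => ?_⟩
    · rintro l (hl | hl) l' (hl' | hl')
      · exact hT l hl l' hl'
      · exact hTS l hl l' hl'
      · exact fun hc => hTS l' hl' l hl hc.symm
      · exact hS' l hl.1 l' hl'.1
    · by_cases hi' : i ∈ I'
      · obtain ⟨s, hs⟩ := hS'I i hi'
        exact ⟨s, Or.inr ⟨hs, i, hi', s, rfl⟩⟩
      · have : ¬ ∀ s, G i s ∉ U ∪ R := fun h => hi' (Finset.mem_filter.2 ⟨hi, h⟩)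
        push Not at this
        obtain ⟨s, hs⟩ := this
        exact ⟨s, Or.inl hs⟩

/-- Literals on one variable are intervals containing 0 or 1, so pairwise compatibility suffices:
the largest lower bound is below every upper bound. -/
theorem exists_holds_of_nonconflicting [NeZero q] (S : Set (GridLiteral n q))
    (hS : ∀ l ∈ S, ∀ l' ∈ S, ¬ Conf 0 l l') :
    ∃ x : Fin n → unitInterval, ∀ l ∈ S, l.Holds 0 x := by
  classical
  have hq : (0 : ℝ) < q := by exact_mod_cast NeZero.pos q
  have hfrac : ∀ i : Fin q, 1 - ((i : ℕ) : ℝ) / q ∈ unitInterval := by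
    intro i
    have h1 : ((i : ℕ) : ℝ) / q ≤ 1 := (div_le_one hq).2 (by exact_mod_cast i.2.le)
    have h2 : 0 ≤ ((i : ℕ) : ℝ) / q := by positivity
    exact ⟨by linarith, by linarith⟩
  -- The largest lower bound demanded at `j`; the empty supremum is 0.
  let x : Fin n → unitInterval := fun j =>
    (Finset.univ.filter fun i : Fin q => (j, false, i) ∈ S).sup fun i => ⟨_, hfrac i⟩
  refine ⟨x, ?_⟩
  rintro ⟨j, b, i⟩ hl
  cases b
  · have h := Finset.le_sup (f := fun i : Fin q => (⟨_, hfrac i⟩ : unitInterval))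
      (by simpa using hl : i ∈ Finset.univ.filter fun i : Fin q => (j, false, i) ∈ S)
    simp only [GridLiteral.Holds, Nat.cast_zero, add_zero]
    exact h
  · have hi : ((i : ℕ) : ℝ) / q ∈ unitInterval :=
      ⟨by positivity, (div_le_one hq).2 (by exact_mod_cast i.2.le)⟩
    have h : x j ≤ ⟨_, hi⟩ := by
      refine Finset.sup_le fun i' hi' => ?_
      have hc := hS _ hl _ (Finset.mem_filter.1 hi').2
      simp only [Conf, ne_eq, reduceCtorEq, not_false_eq_true, true_and, mul_zero, add_zero,
        not_lt] at hc
      have hc' : (q : ℝ) ≤ ((i : ℕ) : ℝ) + (i' : ℕ) := by exact_mod_cast hc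
      rw [Subtype.mk_le_mk, sub_le_iff_le_add, ← add_div, one_le_div hq]
      exact hc'
    simp only [GridLiteral.Holds, Nat.cast_zero, add_zero]
    exact h

theorem gridSat_of_no_closedWalks [NeZero q] (G : GridFormula n q m)
    (hG : ∀ j : Fin n, ∃ σ, ∀ r o, ¬ ClosedWalk G (j, σ, 0) r o) : GridSat 0 G := by
  obtain ⟨S, hS, hGS⟩ := exists_nonconflicting G hG Finset.univ
  obtain ⟨x, hx⟩ := exists_holds_of_nonconflicting S hS
  refine ⟨x, fun i => ?_⟩
  obtain ⟨s, hs⟩ := hGS i (Finset.mem_univ i)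
  exact ⟨s, hx _ hs⟩

/-- A shortest closed walk is cut at its first arrival at a variable of `W` or at one of its own
earlier variables. Minimality yields the last clause, which later excludes a clause shared by the
two chains. -/
theorem exists_minimal_walk [NeZero q] {G : GridFormula n q m} {j : Fin n} {σ : Bool}
    (h : ∃ r o, ClosedWalk G (j, σ, 0) r o) (W : Set (Fin n)) :
    ∃ (r : ℕ) (o : ℕ → Fin m × Fin 2), Conf 0 (j, σ, 0) (prem G (o 0)) ∧
      (∀ t < r, Step G (o t) (o (t + 1))) ∧
      (∀ t t', t < t' → t' ≤ r → (prem G (o t)).1 ≠ (prem G (o t')).1) ∧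
      (∀ t, 0 < t → t ≤ r → (prem G (o t)).1 ∉ W) ∧
      ((concl G (o r)).1 ∈ W ∨ ∃ t ≤ r, (concl G (o r)).1 = (prem G (o t)).1) ∧
      ∀ t ≤ r, (concl G (o t)).1 = j → (concl G (o t)).2.1 ≠ σ := by
  classical
  obtain ⟨o, h0, hs, hr⟩ := Nat.find_spec h
  have hmin : ∀ r < Nat.find h, ∀ o, ¬ ClosedWalk G (j, σ, 0) r o := fun r hr' o ho =>
    Nat.find_min h hr' ⟨o, ho⟩
  set r₀ := Nat.find h with hr₀
  -- An early return to `j` would give a shorter closed walk: with relation `σ` the walk can restart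
  -- there, with the other relation it can stop there.
  have hint : ∀ t < r₀, (concl G (o t)).1 ≠ j := by
    intro t ht hj
    by_cases hσ : (concl G (o t)).2.1 = σ
    · refine hmin (r₀ - (t + 1)) (by omega) (fun k => o (t + 1 + k)) ⟨?_, ?_, ?_⟩
      · have h1 := hs t ht
        refine conf_extreme.2 ⟨h1.1.symm.trans hj, ?_⟩
        rw [← hσ]
        exact h1.2.1.symm
      · exact fun k hk => hs (t + 1 + k) (by omega)
      · simpa only [Nat.add_sub_cancel' (show t + 1 ≤ r₀ from ht)] using hr
    · exact hmin t ht o ⟨h0, fun k hk => hs k (hk.trans ht), (conf_extreme.2 ⟨hj, hσ⟩).symm⟩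
  have hr' := conf_extreme.1 hr.symm
  have h0' := conf_extreme.1 h0
  have hex : ∃ r, (concl G (o r)).1 ∈ W ∨ ∃ t ≤ r, (concl G (o r)).1 = (prem G (o t)).1 :=
    ⟨r₀, Or.inr ⟨0, Nat.zero_le _, hr'.1.trans h0'.1.symm⟩⟩
  have hle : Nat.find hex ≤ r₀ :=
    Nat.find_min' hex (Or.inr ⟨0, Nat.zero_le _, hr'.1.trans h0'.1.symm⟩)
  -- The premise at time t is on the variable of the conclusion at time t - 1, where the stopping
  -- condition does not yet hold.
  have hpred : ∀ t, 0 < t → t ≤ Nat.find hex →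
      ¬((prem G (o t)).1 ∈ W ∨ ∃ k ≤ t - 1, (prem G (o t)).1 = (prem G (o k)).1) := by
    intro t ht0 ht
    obtain ⟨t, rfl⟩ := Nat.exists_eq_succ_of_ne_zero ht0.ne'
    have h1 := Nat.find_min hex (show t < Nat.find hex from ht)
    have h2 := (hs t (lt_of_lt_of_le ht hle)).1
    rw [h2] at h1
    exact h1
  refine ⟨Nat.find hex, o, h0, fun t ht => hs t (ht.trans_le hle), ?_, ?_, Nat.find_spec hex, ?_⟩
  · intro t t' htt' ht' he
    exact hpred t' (by omega) ht' (Or.inr ⟨t, by omega, he.symm⟩)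
  · exact fun t ht0 ht hW => hpred t ht0 ht (Or.inl hW)
  · intro t ht hj
    rcases (ht.trans hle).lt_or_eq with hlt | rfl
    · exact absurd hj (hint t hlt)
    · exact hr'.2

/-- Two chains of forced literals, with premises `P`, `P'` and conclusions `Q`, `Q'`, that start
at the same variable and each of which ends at a variable that was visited before. -/
def Bicycle (r s : ℕ) (P Q : Fin (r + 1) → GridLiteral n q) (P' Q' : Fin (s + 1) → GridLiteral n q) :
    Prop :=
  (∀ t : Fin r, Conf 0 (Q t.castSucc) (P t.succ)) ∧
  (∀ t : Fin s, Conf 0 (Q' t.castSucc) (P' t.succ)) ∧ (P' 0).1 = (P 0).1 ∧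
  (∃ t, (Q (Fin.last r)).1 = (P t).1) ∧
  ∃ t : Fin (r + 1) ⊕ Fin (s + 1), (Q' (Fin.last s)).1 = (Sum.elim P P' t).1

/-- Reusing a clause in the same direction repeats a premise. In the opposite direction it is
possible only at consecutive times, and there a literal would conflict with itself. -/
theorem ne_of_step_chain {G : GridFormula n q m} {r : ℕ} {o : ℕ → Fin m × Fin 2}
    (hs : ∀ t < r, Step G (o t) (o (t + 1)))
    (hd : ∀ t t', t < t' → t' ≤ r → (prem G (o t)).1 ≠ (prem G (o t')).1) {t t' : ℕ}
    (htt' : t < t') (ht' : t' ≤ r) : (o t).1 ≠ (o t').1 := by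
  intro he
  have hst := hs t (by omega)
  have h2 : ∀ a b : Fin 2, a = b ∨ b = a + 1 := by decide
  rcases h2 (o t).2 (o t').2 with h | h
  · exact hd t t' htt' ht' (by rw [show o t = o t' from Prod.ext he h])
  · have h3 : prem G (o t') = concl G (o t) := by
      rw [← prem_turn, show turn (o t) = o t' from Prod.ext he h.symm]
    have h4 : t' = t + 1 := by
      by_contra hne
      refine hd (t + 1) t' (by omega) ht' ?_
      rw [h3]
      exact hst.1.symm
    subst h4
    have := hst.2.1
    rw [h3] at this
    exact this rfl

/-- The second chain is cut where it meets the first. All clauses are distinct, so in a random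
formula the literals of the bicycle are independent. -/
theorem exists_bicycle [NeZero q] {G : GridFormula n q m} {j : Fin n}
    (h : ∀ σ, ∃ r o, ClosedWalk G (j, σ, 0) r o) :
    ∃ (r s : ℕ) (o : Fin (r + 1) ⊕ Fin (s + 1) → Fin m × Fin 2),
      Function.Injective (fun a => (o a).1) ∧
      Bicycle r s (fun t => prem G (o (.inl t))) (fun t => concl G (o (.inl t)))
        (fun t => prem G (o (.inr t))) (fun t => concl G (o (.inr t))) := by
  obtain ⟨r, o, h0, hs, hd, -, he, hσ⟩ := exists_minimal_walk (h true) ∅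
  obtain ⟨s, o', h0', hs', hd', hW', he', -⟩ := exists_minimal_walk (h false)
    {k | ∃ t ≤ r, k = (prem G (o t)).1}
  have he : ∃ t ≤ r, (concl G (o r)).1 = (prem G (o t)).1 := by simpa using he
  have h0 := conf_extreme.1 h0
  have h0' := conf_extreme.1 h0'
  have hcross : ∀ t ≤ r, ∀ u ≤ s, (o t).1 ≠ (o' u).1 := by
    intro t ht u hu heq
    have hQ : ∃ k ≤ r, (concl G (o t)).1 = (prem G (o k)).1 := by
      rcases ht.lt_or_eq with ht | rfl
      · exact ⟨t + 1, ht, (hs t ht).1⟩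
      · exact he
    have h2 : ∀ a b : Fin 2, a = b ∨ b = a + 1 := by decide
    -- A clause common to both chains must be the first of the second chain, since later premises
    -- avoid the first chain. In the same direction it also starts the first chain, but the two
    -- starting premises have opposite relations. In the opposite direction the first chain would
    -- conclude a literal on `j` with relation `true`, against `hσ`.
    rcases h2 (o t).2 (o' u).2 with h | h
    · have h3 : o t = o' u := Prod.ext heq h
      have hu0 : u = 0 := by
        by_contra hne
        exact hW' u (by omega) hu ⟨t, ht, by rw [h3]⟩
      subst hu0
      have ht0 : t = 0 := by
        by_contra hne
        refine hd 0 t (by omega) ht ?_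
        rw [h3, h0'.1, h0.1]
      subst ht0
      have h4 := h0.2
      have h5 := h0'.2
      rw [h3] at h4
      cases hb : (prem G (o' 0)).2.1 <;> simp_all
    · have h3 : prem G (o' u) = concl G (o t) := by
        rw [← prem_turn, show turn (o t) = o' u from Prod.ext heq h.symm]
      have hu0 : u = 0 := by
        by_contra hne
        obtain ⟨k, hk, hk'⟩ := hQ
        exact hW' u (by omega) hu ⟨k, hk, by rw [h3, hk']⟩
      subst hu0
      refine hσ t ht (by rw [← h3, h0'.1]) ?_
      rw [← h3]
      simpa using h0'.2
  refine ⟨r, s, Sum.elim (fun t => o t) (fun t => o' t), ?_, fun t => ?_, fun t => ?_, ?_, ?_, ?_⟩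
  · rintro (a | a) (b | b) hab
    · rcases lt_trichotomy (a : ℕ) b with hlt | heq | hlt
      · exact absurd hab (ne_of_step_chain hs hd hlt (by omega))
      · rw [Fin.ext heq]
      · exact absurd hab.symm (ne_of_step_chain hs hd hlt (by omega))
    · exact absurd hab (hcross a (by omega) b (by omega))
    · exact absurd hab.symm (hcross b (by omega) a (by omega))
    · rcases lt_trichotomy (a : ℕ) b with hlt | heq | hlt
      · exact absurd hab (ne_of_step_chain hs' hd' hlt (by omega))
      · rw [Fin.ext heq]
      · exact absurd hab.symm (ne_of_step_chain hs' hd' hlt (by omega))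
  · exact hs t t.2
  · exact hs' t t.2
  · exact h0'.1.trans h0.1.symm
  · obtain ⟨t, ht, he⟩ := he
    exact ⟨⟨t, by omega⟩, he⟩
  · rcases he' with ⟨t, ht, he'⟩ | ⟨t, ht, he'⟩
    · exact ⟨.inl ⟨t, by omega⟩, he'⟩
    · exact ⟨.inr ⟨t, by omega⟩, he'⟩

end Walks


/-! ### Counting bicycles. -/

section BicycleCount

variable {n q : ℕ}

open Classical in
theorem prob_eq_card_div {Ω : Type*} [Fintype Ω] (S : Ω → Prop) :
    prob S = (Finset.univ.filter S).card / Fintype.card Ω := by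
  rw [prob, avg, Finset.sum_boole]

theorem card_filter_add_lt (e : ℕ) (i : ℕ) :
    (Finset.univ.filter fun i' : Fin q => i + i' + 2 * e < q).card = q - 2 * e - i := by
  have h : (Finset.univ.filter fun i' : Fin q => i + i' + 2 * e < q) =
      Finset.univ.filter fun i' : Fin q => (i' : ℕ) < q - 2 * e - i := by
    ext i'
    simp only [Finset.mem_filter, Finset.mem_univ, true_and]
    omega
  rw [h, Fin.card_filter_val_lt]
  omega

theorem sum_sub_mul_two (q : ℕ) : (∑ i : Fin q, (q - i : ℕ)) * 2 = q * (q + 1) := by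
  rw [Fin.sum_univ_eq_sum_range (fun i => q - i) q]
  induction q with
  | zero => simp
  | succ q ih =>
    rw [Finset.sum_range_succ', add_mul]
    simp only [Nat.add_sub_add_right, ih]
    ring_nf
    omega

-- The variable and the first relation are free, the second relation is determined, and q(q + 1)/2
-- pairs of indices have sum below `q`.
open Classical in
theorem card_conf_pairs : Fintype.card {c : GridLiteral n q × GridLiteral n q // Conf 0 c.1 c.2} =
    n * (q * (q + 1)) := by
  let f : {c : GridLiteral n q × GridLiteral n q // Conf 0 c.1 c.2} ≃
      Fin n × Bool × (i : Fin q) × {i' : Fin q // (i : ℕ) + i' + 2 * 0 < q} :=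
    { toFun := fun c => (c.1.1.1, c.1.1.2.1, ⟨c.1.1.2.2, c.1.2.2.2, c.2.2.2⟩)
      invFun := fun d => ⟨((d.1, d.2.1, d.2.2.1), (d.1, !d.2.1, d.2.2.2.1)),
        rfl, by simp, d.2.2.2.2⟩
      left_inv := by
        rintro ⟨⟨⟨j, b, i⟩, ⟨j', b', i'⟩⟩, h1, h2, h3⟩
        simp only at h1 h2
        have : (!b) = b' := by cases b <;> cases b' <;> simp_all
        simp [h1, this]
      right_inv := by
        rintro ⟨j, b, i, i', h⟩
        rfl }
  rw [Fintype.card_congr f, Fintype.card_prod, Fintype.card_prod, Fintype.card_sigma]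
  simp only [Fintype.card_subtype, card_filter_add_lt]
  rw [Fintype.card_bool, Fintype.card_fin, ← sum_sub_mul_two q, mul_comm 2]
  simp

/-- The data from which the literals of a bicycle can be read off. -/
abbrev BicycleCode (n q r s : ℕ) : Type :=
  (Fin r → {c : GridLiteral n q × GridLiteral n q // Conf 0 c.1 c.2}) ×
  (Fin s → {c : GridLiteral n q × GridLiteral n q // Conf 0 c.1 c.2}) ×
  GridLiteral n q × (Bool × Fin q) × (Fin (r + 1) × Bool × Fin q) ×
  ((Fin (r + 1) ⊕ Fin (s + 1)) × Bool × Fin q)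

/-- The literals of the bicycle with a given code. -/
def BicycleCode.literals {r s : ℕ} (d : BicycleCode n q r s) :
    (Fin (r + 1) ⊕ Fin (s + 1)) × Fin 2 → GridLiteral n q :=
  let P : Fin (r + 1) → GridLiteral n q := Fin.cons d.2.2.1 fun t => (d.1 t).1.2
  let P' : Fin (s + 1) → GridLiteral n q :=
    Fin.cons (d.2.2.1.1, d.2.2.2.1) fun t => (d.2.1 t).1.2
  let Q : Fin (r + 1) → GridLiteral n q :=
    Fin.snoc (α := fun _ => GridLiteral n q) (fun t => (d.1 t).1.1)
      ((P d.2.2.2.2.1.1).1, d.2.2.2.2.1.2)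
  let Q' : Fin (s + 1) → GridLiteral n q :=
    Fin.snoc (α := fun _ => GridLiteral n q) (fun t => (d.2.1 t).1.1)
      ((Sum.elim P P' d.2.2.2.2.2.1).1, d.2.2.2.2.2.2)
  fun x => if x.2 = 0 then Sum.elim P P' x.1 else Sum.elim Q Q' x.1

theorem exists_bicycleCode {r s : ℕ} (L : (Fin (r + 1) ⊕ Fin (s + 1)) × Fin 2 → GridLiteral n q)
    (h : Bicycle r s (fun t => L (.inl t, 0)) (fun t => L (.inl t, 1)) (fun t => L (.inr t, 0))
      (fun t => L (.inr t, 1))) : ∃ d : BicycleCode n q r s, d.literals = L := by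
  obtain ⟨h1, h2, h3, ⟨t, ht⟩, ⟨t', ht'⟩⟩ := h
  let d : BicycleCode n q r s := (fun t => ⟨(L (.inl t.castSucc, 1), L (.inl t.succ, 0)), h1 t⟩,
    fun t => ⟨(L (.inr t.castSucc, 1), L (.inr t.succ, 0)), h2 t⟩, L (.inl 0, 0),
    (L (.inr 0, 0)).2, (t, (L (.inl (Fin.last r), 1)).2), (t', (L (.inr (Fin.last s), 1)).2))
  have hP : (Fin.cons d.2.2.1 (fun t => (d.1 t).1.2) : Fin (r + 1) → GridLiteral n q) =
      fun t => L (.inl t, 0) := by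
    funext k
    cases k using Fin.cases <;> rfl
  have hP' : (Fin.cons (d.2.2.1.1, d.2.2.2.1) (fun t => (d.2.1 t).1.2) :
      Fin (s + 1) → GridLiteral n q) = fun t => L (.inr t, 0) := by
    funext k
    cases k using Fin.cases
    · rw [Fin.cons_zero]
      exact Prod.ext h3.symm rfl
    · rfl
  refine ⟨d, ?_⟩
  funext x
  obtain ⟨a, b⟩ := x
  simp only [BicycleCode.literals, hP, hP']
  have hb : ∀ b : Fin 2, b = 0 ∨ b = 1 := by decide
  rcases hb b with rfl | rfl
  · rw [if_pos rfl]
    cases a <;> rfl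
  · rw [if_neg (by simp)]
    cases a with
    | inl a =>
      rw [Sum.elim_inl]
      cases a using Fin.lastCases
      · rw [Fin.snoc_last]
        exact Prod.ext ht.symm rfl
      · rw [Fin.snoc_castSucc]
    | inr a =>
      rw [Sum.elim_inr]
      cases a using Fin.lastCases
      · rw [Fin.snoc_last]
        refine Prod.ext ?_ rfl
        rw [ht']
      · rw [Fin.snoc_castSucc]

/-- Bicycles are counted by their codes: r + s conflicting pairs, two premises on a common variable,
and two final conclusions whose variables are chosen among those visited. This leaves only r + s + 1
free variables for 2(r + s + 2) literals. -/
theorem prob_bicycle_le (r s : ℕ) :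
    prob (fun L : (Fin (r + 1) ⊕ Fin (s + 1)) × Fin 2 → GridLiteral n q =>
      Bicycle r s (fun t => L (.inl t, 0)) (fun t => L (.inl t, 1)) (fun t => L (.inr t, 0))
        (fun t => L (.inr t, 1))) ≤
      (n * (q * (q + 1))) ^ (r + s) * ((n * (2 * q)) * (2 * q) * ((r + 1) * (2 * q)) *
        ((r + s + 2) * (2 * q))) / ((n * (2 * q)) ^ (2 * (r + s + 2))) := by
  classical
  rw [prob_eq_card_div]
  have h1 : (Finset.univ.filter fun L : (Fin (r + 1) ⊕ Fin (s + 1)) × Fin 2 → GridLiteral n q =>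
      Bicycle r s (fun t => L (.inl t, 0)) (fun t => L (.inl t, 1)) (fun t => L (.inr t, 0))
        (fun t => L (.inr t, 1))).card ≤ Fintype.card (BicycleCode n q r s) := by
    rw [← Finset.card_univ]
    refine (Finset.card_le_card (t := Finset.univ.image BicycleCode.literals) fun L hL => ?_).trans
      Finset.card_image_le
    obtain ⟨d, hd⟩ := exists_bicycleCode L (Finset.mem_filter.1 hL).2
    exact Finset.mem_image.2 ⟨d, Finset.mem_univ d, hd⟩
  have h2 : (Fintype.card (BicycleCode n q r s) : ℝ) =
      (n * (q * (q + 1))) ^ (r + s) * ((n * (2 * q)) * (2 * q) * ((r + 1) * (2 * q)) *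
        ((r + s + 2) * (2 * q))) := by
    simp only [BicycleCode, Fintype.card_prod, Fintype.card_fun, card_conf_pairs, Fintype.card_fin,
      Fintype.card_bool, Fintype.card_sum]
    push_cast
    ring
  have h3 : (Fintype.card ((Fin (r + 1) ⊕ Fin (s + 1)) × Fin 2 → GridLiteral n q) : ℝ) =
      (n * (2 * q)) ^ (2 * (r + s + 2)) := by
    simp only [Fintype.card_prod, Fintype.card_fun, Fintype.card_fin,
      Fintype.card_bool, Fintype.card_sum]
    push_cast
    congr 1
    ring
  rw [h3, ← h2]
  gcongr

end BicycleCount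


/-! ### First moment bound for c < 2. -/

section UnionBound

variable {n q m : ℕ}

theorem prob_bicycle_at_le [NeZero n] [NeZero q] (r s : ℕ)
    (o : Fin (r + 1) ⊕ Fin (s + 1) → Fin m × Fin 2) :
    prob (fun G : GridFormula n q m => Function.Injective (fun a => (o a).1) ∧
      Bicycle r s (fun t => prem G (o (.inl t))) (fun t => concl G (o (.inl t)))
        (fun t => prem G (o (.inr t))) (fun t => concl G (o (.inr t)))) ≤
      ((q + 1) / (4 * q * n)) ^ (r + s) * ((r + 1) * (r + s + 2)) / n ^ 3 := by
  by_cases ho : Function.Injective (fun a => (o a).1)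
  · have he : Function.Injective fun x : (Fin (r + 1) ⊕ Fin (s + 1)) × Fin 2 =>
        ((o x.1).1, (o x.1).2 + x.2) := by
      rintro ⟨a, b⟩ ⟨a', b'⟩ h
      obtain ⟨h1, h2⟩ := Prod.mk.inj (show ((o a).1, (o a).2 + b) = ((o a').1, (o a').2 + b') from h)
      obtain rfl : a = a' := ho h1
      rw [add_left_cancel h2]
    -- As a family indexed by slots, the formula is restricted to the slots of the bicycle, which
    -- are distinct by `he`.
    rw [← prob_equiv (Equiv.curry (Fin m) (Fin 2) (GridLiteral n q))]
    refine le_trans (prob_mono fun H hH => ?_) ((prob_comp_injective he (fun L =>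
      Bicycle r s (fun t => L (.inl t, 0)) (fun t => L (.inl t, 1)) (fun t => L (.inr t, 0))
        (fun t => L (.inr t, 1)))).le.trans ((prob_bicycle_le r s).trans_eq ?_))
    · simp only [Function.comp_apply, add_zero]
      exact hH.2
    · have hn : (n : ℝ) ≠ 0 := by exact_mod_cast NeZero.ne n
      have hq : (q : ℝ) ≠ 0 := by exact_mod_cast NeZero.ne q
      rw [show 2 * (r + s + 2) = 2 * (r + s) + 4 by ring, pow_add _ (2 * (r + s)), pow_mul, div_pow]
      have h1 : ((n : ℝ) * (2 * q)) ^ 2 = (4 * q * n) * (q * n) := by ring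
      have h2 : (n : ℝ) * (q * (q + 1)) = (q + 1) * (q * n) := by ring
      rw [h1, h2, mul_pow, mul_pow _ ((q : ℝ) * n)]
      field_simp
  · refine le_trans (prob_mono (T := fun _ => False) fun G hG => ho hG.1) ?_
    simp only [prob, avg, if_false, Finset.sum_const_zero, zero_div]
    positivity

theorem prob_not_gridSat_le_sum [NeZero n] [NeZero q] :
    prob (fun G : GridFormula n q m => ¬ GridSat 0 G) ≤ ∑ r : Fin m, ∑ s : Fin m,
      (4 * ((m : ℝ) / n) ^ 2 / n) * (((q + 1) * m / (2 * q * n)) ^ ((r : ℕ) + s : ℕ) *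
        ((((r : ℕ) : ℝ) + 1) * ((r : ℕ) + (s : ℕ) + 2))) := by
  have hn : (n : ℝ) ≠ 0 := by exact_mod_cast NeZero.ne n
  have hq : (q : ℝ) ≠ 0 := by exact_mod_cast NeZero.ne q
  calc prob (fun G : GridFormula n q m => ¬ GridSat 0 G)
      ≤ prob (fun G : GridFormula n q m => ∃ r : Fin m, ∃ s : Fin m,
        ∃ o : Fin (r + 1) ⊕ Fin (s + 1) → Fin m × Fin 2,
        Function.Injective (fun a => (o a).1) ∧
        Bicycle r s (fun t => prem G (o (.inl t))) (fun t => concl G (o (.inl t)))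
          (fun t => prem G (o (.inr t))) (fun t => concl G (o (.inr t)))) := by
        refine prob_mono fun G hG => ?_
        have h1 : ¬ ∀ j : Fin n, ∃ σ, ∀ r o, ¬ ClosedWalk G (j, σ, 0) r o :=
          fun h => hG (gridSat_of_no_closedWalks G h)
        push Not at h1
        obtain ⟨j, hj⟩ := h1
        obtain ⟨r, s, o, ho, hb⟩ := exists_bicycle hj
        -- Distinct clauses give r + s + 2 ≤ m, so the union bound is over finitely many lengths.
        have hc := Fintype.card_le_of_injective _ ho
        simp only [Fintype.card_sum, Fintype.card_fin] at hc
        exact ⟨⟨r, by omega⟩, ⟨s, by omega⟩, o, ho, hb⟩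
    _ ≤ ∑ r : Fin m, ∑ s : Fin m, ∑ _o : Fin (r + 1) ⊕ Fin (s + 1) → Fin m × Fin 2,
          ((q + 1) / (4 * q * n) : ℝ) ^ ((r : ℕ) + s : ℕ) *
            ((((r : ℕ) : ℝ) + 1) * ((r : ℕ) + (s : ℕ) + 2)) / n ^ 3 := by
        refine (prob_exists_le _).trans (Finset.sum_le_sum fun r _ => ?_)
        refine (prob_exists_le _).trans (Finset.sum_le_sum fun s _ => ?_)
        refine (prob_exists_le _).trans (Finset.sum_le_sum fun o _ => ?_)
        exact prob_bicycle_at_le r s o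
    _ = _ := by
        refine Finset.sum_congr rfl fun r _ => Finset.sum_congr rfl fun s _ => ?_
        rw [Finset.sum_const, Finset.card_univ, nsmul_eq_mul]
        simp only [Fintype.card_fun, Fintype.card_sum, Fintype.card_fin, Fintype.card_prod]
        push_cast
        rw [show (r : ℕ) + 1 + (s + 1) = (r + s) + 2 by ring, pow_add]
        have h1 : ((q + 1) * m / (2 * q * n) : ℝ) = (m * 2) * ((q + 1) / (4 * q * n)) := by
          field_simp
          norm_num
        rw [h1, mul_pow ((m : ℝ) * 2) ((q + 1) / (4 * q * n)) ((r : ℕ) + s)]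
        generalize ((m : ℝ) * 2) ^ ((r : ℕ) + s : ℕ) = A
        generalize (((q : ℝ) + 1) / (4 * q * n)) ^ ((r : ℕ) + s : ℕ) = B
        ring

/-- Each extra step of a chain offers 2m occurrences and costs (q + 1)/(4qn), hence the ratio
bounded by `ρ`. The polynomial factor is split into a product over `r` and `s`, so the double sum is
at most the square of a convergent series that does not depend on `n`. -/
theorem prob_not_gridSat_le [NeZero n] [NeZero q] {ρ : ℝ} (hρ1 : ρ < 1)
    (hρ : (q + 1) * m / (2 * q * n) ≤ ρ) (hmn : (m / n : ℝ) ≤ 2) :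
    prob (fun G : GridFormula n q m => ¬ GridSat 0 G) ≤
      32 * (∑' r : ℕ, ((r : ℝ) + 1) ^ 2 * ρ ^ r) ^ 2 / n := by
  have hn : (0 : ℝ) < n := by exact_mod_cast NeZero.pos n
  have hρ0 : 0 ≤ ρ := le_trans (by positivity) hρ
  have hsum : Summable fun r : ℕ => ((r : ℝ) + 1) ^ 2 * ρ ^ r := by
    have h : ∀ k : ℕ, Summable fun r : ℕ => (r : ℝ) ^ k * ρ ^ r := fun k =>
      summable_pow_mul_geometric_of_norm_lt_one k (by rwa [Real.norm_of_nonneg hρ0])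
    refine (((h 2).add ((h 1).mul_left 2)).add (h 0)).congr fun r => ?_
    ring
  have hle : ∑ r : Fin m, (((r : ℕ) : ℝ) + 1) ^ 2 * ρ ^ (r : ℕ) ≤
      ∑' r : ℕ, ((r : ℝ) + 1) ^ 2 * ρ ^ r := by
    rw [Fin.sum_univ_eq_sum_range (fun r => ((r : ℝ) + 1) ^ 2 * ρ ^ r) m]
    exact hsum.sum_le_tsum _ fun r _ => by positivity
  calc prob (fun G : GridFormula n q m => ¬ GridSat 0 G)
      ≤ ∑ r : Fin m, ∑ s : Fin m, (4 * 2 ^ 2 / (n : ℝ)) * (ρ ^ ((r : ℕ) + s : ℕ) *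
          (2 * ((((r : ℕ) : ℝ) + 1) ^ 2 * (((s : ℕ) : ℝ) + 1) ^ 2))) := by
        refine prob_not_gridSat_le_sum.trans (Finset.sum_le_sum fun r _ =>
          Finset.sum_le_sum fun s _ => ?_)
        gcongr ?_ / _ * (?_ * ?_)
        · gcongr
        · gcongr
        · have hr : (0 : ℝ) ≤ (r : ℕ) := by positivity
          have hs : (0 : ℝ) ≤ (s : ℕ) := by positivity
          nlinarith [mul_nonneg hr hs, mul_nonneg hr (mul_nonneg hr hs), mul_nonneg hr hr,
            mul_nonneg hs hs, mul_nonneg (mul_nonneg hr hr) (mul_nonneg hs hs),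
            mul_nonneg hr (mul_nonneg hs hs), mul_nonneg hr (mul_nonneg hr hs)]
    _ = 32 * (∑ r : Fin m, (((r : ℕ) : ℝ) + 1) ^ 2 * ρ ^ (r : ℕ)) ^ 2 / n := by
        rw [pow_two (∑ r : Fin m, _), Finset.sum_mul_sum, Finset.mul_sum, Finset.sum_div]
        refine Finset.sum_congr rfl fun r _ => ?_
        rw [Finset.mul_sum, Finset.sum_div]
        refine Finset.sum_congr rfl fun s _ => ?_
        rw [pow_add]
        ring
    _ ≤ _ := by
        have : 0 ≤ ∑ r : Fin m, (((r : ℕ) : ℝ) + 1) ^ 2 * ρ ^ (r : ℕ) := by positivity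
        gcongr

theorem tendsto_formulaLawRep_unsat {c : ℝ} (hc : c < 2) {m : ℕ → ℕ}
    (hm : Tendsto (fun n : ℕ => (m n : ℝ) / (n : ℝ)) atTop (𝓝 c)) :
    Tendsto (fun n => formulaLawRep 2 n (m n) {F | F.Satisfiable}ᶜ) atTop (𝓝 0) := by
  -- Rounding raises the density of conflicts by the factor 1 + 1/q, which the gap between c and 2
  -- absorbs.
  have hq : ∃ q : ℕ, 0 < q ∧ c * (1 + 1 / (q : ℝ)) < 2 := by
    have h1 : Tendsto (fun q : ℕ => c * (1 + 1 / (q : ℝ))) atTop (𝓝 (c * (1 + 0))) :=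
      (tendsto_const_nhds.add tendsto_one_div_atTop_nhds_zero_nat).const_mul c
    rw [add_zero, mul_one] at h1
    obtain ⟨q, hq, hq0⟩ := ((h1.eventually_lt_const hc).and (eventually_gt_atTop 0)).exists
    exact ⟨q, hq0, hq⟩
  obtain ⟨q, hq0, hq⟩ := hq
  have : NeZero q := ⟨hq0.ne'⟩
  have hq0' : (0 : ℝ) < q := by exact_mod_cast hq0
  obtain ⟨ρ, hρ, hρ1⟩ := exists_between (show c * (1 + 1 / (q : ℝ)) / 2 < 1 by linarith)
  have h1 : Tendsto (fun n : ℕ => ENNReal.ofReal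
      (32 * (∑' r : ℕ, ((r : ℝ) + 1) ^ 2 * ρ ^ r) ^ 2 / n)) atTop (𝓝 0) := by
    rw [← ENNReal.ofReal_zero]
    exact ENNReal.tendsto_ofReal (tendsto_const_div_atTop_nhds_zero_nat _)
  refine tendsto_of_tendsto_of_tendsto_of_le_of_le' tendsto_const_nhds h1
    (Eventually.of_forall fun _ => zero_le) ?_
  have h2 : Tendsto (fun n : ℕ => (m n : ℝ) / n * (1 + 1 / (q : ℝ)) / 2) atTop
      (𝓝 (c * (1 + 1 / (q : ℝ)) / 2)) := (hm.mul_const _).div_const _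
  filter_upwards [eventually_ge_atTop 1, hm.eventually_le_const hc, h2.eventually_le_const hρ]
    with n hn hmn hmn'
  have : NeZero n := ⟨by omega⟩
  have hn0 : (0 : ℝ) < n := by exact_mod_cast hn
  refine le_trans (measure_mono ?_) ((formulaLawRep_toGrid_le (q := q)
    (fun G => ¬ GridSat 0 G)).trans (ENNReal.ofReal_le_ofReal
    (prob_not_gridSat_le hρ1 ?_ hmn)))
  · rintro F hF ⟨x, hx⟩
    refine hF ⟨x, fun i => ?_⟩
    obtain ⟨s, hs⟩ := hx i
    exact ⟨s, holds_of_toGrid_holds hs⟩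
  · refine le_trans (le_of_eq ?_) hmn'
    field_simp

end UnionBound


/-! ### Exploration of the forced literals, for c > 2. -/

section Exploration

variable {n q : ℕ}

/-- One of the two variables of the clause is `j`. -/
def Touches (j : Fin n) (c : Fin 2 → GridLiteral n q) : Prop := (c 0).1 = j ∨ (c 1).1 = j

/-- The threshold is small enough for the literal to be in conflict with another one. -/
def GridLiteral.Active (l : GridLiteral n q) : Prop := (l.2.2 : ℕ) + 2 < q

/-- The number of literals in conflict with a literal. -/
def GridLiteral.weight (l : GridLiteral n q) : ℕ := q - 2 - l.2.2

/-- `l'` is on a variable different from that of `l` and from those in the list `A`. -/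
def Fresh (l : GridLiteral n q) (A : List (GridLiteral n q)) (l' : GridLiteral n q) : Prop :=
  l'.1 ≠ l.1 ∧ l'.1 ∉ A.map Prod.fst ∧ l'.Active

open Classical in
/-- The literal forced by `l` through the clause `c`, if it is to be added to the list `A`. -/
noncomputable def newLits (l : GridLiteral n q) (A : List (GridLiteral n q))
    (c : Fin 2 → GridLiteral n q) : List (GridLiteral n q) :=
  if Conf 1 l (c 0) ∧ Fresh l A (c 1) then [c 1]
  else if Conf 1 l (c 1) ∧ Fresh l A (c 0) then [c 0] else []

open Classical in
/-- Run through a list of clauses, adding to `A` the literals forced by `l` and collecting the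
clauses that do not touch the variable of `l`. -/
noncomputable def scan (l : GridLiteral n q) : List (Fin 2 → GridLiteral n q) →
    List (GridLiteral n q) → List (Fin 2 → GridLiteral n q) →
    List (GridLiteral n q) × List (Fin 2 → GridLiteral n q)
  | [], A, S => (A, S)
  | c :: U, A, S => if Touches l.1 c then scan l U (newLits l A c ++ A) S else scan l U A (c :: S)

/-- The exploration of the forced literals, from the list `A`, dies out within `t` rounds and
before `H` unprocessed literals are available. -/
def Fails (H : ℕ) : ℕ → List (GridLiteral n q) → List (Fin 2 → GridLiteral n q) → Prop
  | 0, _, _ => False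
  | _ + 1, [], _ => 0 < H
  | t + 1, l :: A, F => A.length + 1 < H ∧ Fails H t (scan l F A []).1 (scan l F A []).2

theorem not_fails_of_le_length {H : ℕ} (t : ℕ) {A : List (GridLiteral n q)}
    (F : List (Fin 2 → GridLiteral n q)) (h : H ≤ A.length) : ¬ Fails H t A F := by
  cases t with
  | zero => exact id
  | succ t =>
    cases A with
    | nil =>
      simp only [List.length_nil] at h
      simp only [Fails]
      omega
    | cons l A =>
      simp only [List.length_cons] at h
      simp only [Fails, not_and]
      omega

theorem length_le_length_scan (l : GridLiteral n q) (U : List (Fin 2 → GridLiteral n q))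
    (A : List (GridLiteral n q)) (S : List (Fin 2 → GridLiteral n q)) :
    A.length ≤ (scan l U A S).1.length := by
  induction U generalizing A S with
  | nil => exact le_rfl
  | cons c U ih =>
    rw [scan]
    split_ifs
    · refine le_trans ?_ (ih _ _)
      simp
    · exact ih _ _

theorem newLits_eq (l : GridLiteral n q) (A : List (GridLiteral n q))
    (c : Fin 2 → GridLiteral n q) : newLits l A c = [] ∨
      ∃ s, newLits l A c = [c s] ∧ Conf 1 l (c (s + 1)) ∧ Fresh l A (c s) := by
  unfold newLits
  split_ifs with h1 h2
  · exact Or.inr ⟨1, rfl, h1.1, h1.2⟩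
  · exact Or.inr ⟨0, rfl, h2.1, h2.2⟩
  · exact Or.inl rfl

/-- The literals of the list are on distinct variables, different from `j`, and active. -/
def Admissible (j : Fin n) (A : List (GridLiteral n q)) : Prop :=
  (A.map Prod.fst).Nodup ∧ j ∉ A.map Prod.fst ∧ ∀ l ∈ A, l.Active

theorem Admissible.newLits_append {l : GridLiteral n q} {A : List (GridLiteral n q)}
    (hA : Admissible l.1 A) (c : Fin 2 → GridLiteral n q) :
    Admissible l.1 (newLits l A c ++ A) := by
  rcases newLits_eq l A c with h | ⟨s, h, -, hf⟩
  · simpa [h] using hA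
  · rw [h]
    refine ⟨?_, ?_, ?_⟩
    · simpa using ⟨by simpa using hf.2.1, hA.1⟩
    · rw [List.map_append, List.mem_append]
      rintro (h' | h')
      · exact hf.1 (List.mem_singleton.1 h').symm
      · exact hA.2.1 h'
    · intro l' hl'
      rcases List.mem_append.1 hl' with h' | h'
      · rw [List.mem_singleton.1 h']
        exact hf.2.2
      · exact hA.2.2 l' h'

theorem scan_spec (l : GridLiteral n q) (U : List (Fin 2 → GridLiteral n q))
    (A : List (GridLiteral n q)) (S : List (Fin 2 → GridLiteral n q)) (hA : Admissible l.1 A) :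
    Admissible l.1 (scan l U A S).1 ∧
    (∀ c ∈ (scan l U A S).2, c ∈ S ∨ (c ∈ U ∧ ¬ Touches l.1 c)) ∧
    (∀ l' ∈ (scan l U A S).1, l' ∈ A ∨ ∃ c ∈ U, ∃ s, l' = c s ∧ Conf 1 l (c (s + 1))) := by
  induction U generalizing A S with
  | nil => exact ⟨hA, fun c hc => Or.inl hc, fun l' hl' => Or.inl hl'⟩
  | cons c U ih =>
    rw [scan]
    split_ifs with hc
    · obtain ⟨h1, h2, h3⟩ := ih _ S (hA.newLits_append c)
      refine ⟨h1, fun c' hc' => ?_, fun l' hl' => ?_⟩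
      · rcases h2 c' hc' with h | h
        · exact Or.inl h
        · exact Or.inr ⟨List.mem_cons_of_mem _ h.1, h.2⟩
      · rcases h3 l' hl' with h | ⟨c', hc', h⟩
        · rcases List.mem_append.1 h with h | h
          · rcases newLits_eq l A c with h' | ⟨s, h', hs, -⟩
            · simp [h'] at h
            · rw [h', List.mem_singleton] at h
              exact Or.inr ⟨c, List.mem_cons_self, s, h, hs⟩
          · exact Or.inl h
        · exact Or.inr ⟨c', List.mem_cons_of_mem _ hc', h⟩
    · obtain ⟨h1, h2, h3⟩ := ih A (c :: S) hA
      refine ⟨h1, fun c' hc' => ?_, fun l' hl' => ?_⟩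
      · rcases h2 c' hc' with h | h
        · rcases List.mem_cons.1 h with rfl | h
          · exact Or.inr ⟨List.mem_cons_self, hc⟩
          · exact Or.inl h
        · exact Or.inr ⟨List.mem_cons_of_mem _ h.1, h.2⟩
      · rcases h3 l' hl' with h | ⟨c', hc', h⟩
        · exact Or.inl h
        · exact Or.inr ⟨c', List.mem_cons_of_mem _ hc', h⟩

/-- If the exploration does not fail, then many literals on distinct variables are forced. -/
theorem exists_forced_of_not_fails {H : ℕ} (t : ℕ) (A : List (GridLiteral n q))
    (F : List (Fin 2 → GridLiteral n q)) (hnd : (A.map Prod.fst).Nodup)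
    (hact : ∀ l ∈ A, l.Active) (h : ¬ Fails H t A F) :
    ∃ T : List (GridLiteral n q), (T.map Prod.fst).Nodup ∧ min t H ≤ T.length ∧
      (∀ l ∈ T, l.Active) ∧
      (∀ l ∈ T, l.1 ∈ A.map Prod.fst ∨ ∃ c ∈ F, Touches l.1 c) ∧
      ∀ x : Fin n → unitInterval, (∀ c ∈ F, ∃ s, (c s).Holds 1 x) → (∀ l ∈ A, l.Holds 1 x) →
        ∀ l ∈ T, l.Holds 1 x := by
  induction t generalizing A F with
  | zero => exact ⟨[], by simp, by simp, by simp, by simp, by simp⟩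
  | succ t ih =>
    by_cases hH : H ≤ A.length
    · exact ⟨A, hnd, by omega, hact, fun l hl => Or.inl (List.mem_map_of_mem hl),
        fun x _ hx => hx⟩
    · cases A with
      | nil =>
        simp only [Fails, List.length_nil] at h hH
        omega
      | cons l A =>
        simp only [List.length_cons, not_le] at hH
        simp only [Fails, not_and] at h
        have hA : Admissible l.1 A := by
          rw [List.map_cons, List.nodup_cons] at hnd
          exact ⟨hnd.2, hnd.1, fun l' hl' => hact l' (List.mem_cons_of_mem _ hl')⟩
        obtain ⟨h1, h2, h3⟩ := scan_spec l F A [] hA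
        obtain ⟨T, hT1, hT2, hT3, hT4, hT5⟩ := ih _ _ h1.1 h1.2.2 (h hH)
        refine ⟨l :: T, ?_, ?_, ?_, ?_, ?_⟩
        · rw [List.map_cons, List.nodup_cons]
          -- The variable of `l` never returns: the updated list avoids it, and the clauses kept for
          -- later do not touch it.
          refine ⟨fun hl => ?_, hT1⟩
          obtain ⟨l', hl', he⟩ := List.mem_map.1 hl
          rcases hT4 l' hl' with hl'' | ⟨c, hc, ht⟩
          · exact h1.2.1 (he ▸ hl'')
          · rcases h2 c hc with h' | h'
            · simp at h'
            · exact h'.2 (he ▸ ht)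
        · rw [List.length_cons]
          omega
        · intro l' hl'
          rcases List.mem_cons.1 hl' with rfl | hl'
          · exact hact _ List.mem_cons_self
          · exact hT3 l' hl'
        · intro l' hl'
          rcases List.mem_cons.1 hl' with rfl | hl'
          · exact Or.inl (by simp)
          · rcases hT4 l' hl' with hl'' | ⟨c, hc, ht⟩
            · obtain ⟨l'', hl3, he⟩ := List.mem_map.1 hl''
              rcases h3 l'' hl3 with h' | ⟨c, hc, s, h', -⟩
              · refine Or.inl ?_
                rw [← he]
                exact List.mem_map_of_mem (List.mem_cons_of_mem _ h')
              · refine Or.inr ⟨c, hc, ?_⟩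
                rw [← he, h']
                fin_cases s
                · exact Or.inl rfl
                · exact Or.inr rfl
            · rcases h2 c hc with h' | h'
              · simp at h'
              · exact Or.inr ⟨c, h'.1, ht⟩
        · intro x hF hA'
          have hl := hA' l List.mem_cons_self
          have hT := hT5 x (fun c hc => ?_) (fun l' hl' => ?_)
          · intro l' hl'
            rcases List.mem_cons.1 hl' with rfl | hl'
            · exact hl
            · exact hT l' hl'
          · rcases h2 c hc with h' | h'
            · simp at h'
            · exact hF c h'.1
          · rcases h3 l' hl' with h' | ⟨c, hc, s, rfl, hconf⟩
            · exact hA' l' (List.mem_cons_of_mem _ h')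
            · obtain ⟨s', hs'⟩ := hF c hc
              have hne : s' ≠ s + 1 := fun he => hconf.not_holds hl (he ▸ hs')
              have : ∀ s s' : Fin 2, s' ≠ s + 1 → s' = s := by decide
              rwa [this s s' hne] at hs'

end Exploration


/-! ### Sums over lists of clauses. -/

section ListSum

variable {K : Type*}

/-- The sum of a function over the lists of length `k` with entries in `s`. -/
noncomputable def listSum (s : Finset K) : ℕ → (List K → ℝ) → ℝ
  | 0, f => f []
  | k + 1, f => ∑ c ∈ s, listSum s k fun L => f (c :: L)

theorem listSum_mono (s : Finset K) (k : ℕ) {f g : List K → ℝ} (h : ∀ L, f L ≤ g L) :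
    listSum s k f ≤ listSum s k g := by
  induction k generalizing f g with
  | zero => exact h []
  | succ k ih => exact Finset.sum_le_sum fun c _ => ih fun L => h (c :: L)

theorem listSum_const (s : Finset K) (k : ℕ) (a : ℝ) :
    listSum s k (fun _ => a) = (s.card : ℝ) ^ k * a := by
  induction k with
  | zero => simp [listSum]
  | succ k ih =>
    simp only [listSum, ih, Finset.sum_const, nsmul_eq_mul]
    ring

theorem listSum_sum (s : Finset K) {κ : Type*} (t : Finset κ) (k : ℕ) (f : κ → List K → ℝ) :
    listSum s k (fun L => ∑ x ∈ t, f x L) = ∑ x ∈ t, listSum s k (f x) := by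
  induction k generalizing f with
  | zero => rfl
  | succ k ih =>
    simp only [listSum, ih]
    exact Finset.sum_comm

theorem listSum_ofFn [Fintype K] (k : ℕ) (f : List K → ℝ) :
    listSum Finset.univ k f = ∑ F : Fin k → K, f (List.ofFn F) := by
  induction k generalizing f with
  | zero => simp [listSum]
  | succ k ih =>
    simp only [listSum, ih]
    rw [← (Fin.consEquiv fun _ : Fin (k + 1) => K).sum_comp, Fintype.sum_prod_type]
    simp [Fin.consEquiv, List.ofFn_succ]

end ListSum

/-! ### The exponential gain from one clause. -/

section GrowthBound

variable {n q : ℕ}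

open Classical in
/-- The clauses with both variables in `V`. -/
noncomputable def clausesOn (q : ℕ) (V : Finset (Fin n)) : Finset (Fin 2 → GridLiteral n q) :=
  Finset.univ.filter fun c => (c 0).1 ∈ V ∧ (c 1).1 ∈ V

theorem sum_clauses (f : (Fin 2 → GridLiteral n q) → ℝ) :
    ∑ c, f c = ∑ a : GridLiteral n q, ∑ b : GridLiteral n q, f ![a, b] := by
  rw [← (finTwoArrowEquiv (GridLiteral n q)).symm.sum_comp, Fintype.sum_prod_type]
  rfl

open Classical in
theorem sum_literals_on (V : Finset (Fin n)) (f : Fin q → ℝ) :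
    ∑ a : GridLiteral n q, (if a.1 ∈ V then f a.2.2 else 0) = V.card * (2 * ∑ i, f i) := by
  simp only [Fintype.sum_prod_type, Fintype.sum_bool]
  have h : ∀ j : Fin n, ((∑ i : Fin q, if j ∈ V then f i else 0) +
      ∑ i : Fin q, if j ∈ V then f i else 0) = if j ∈ V then 2 * ∑ i, f i else 0 := by
    intro j
    split_ifs
    · ring
    · simp
  simp only [h]
  rw [← Finset.sum_filter]
  simp

theorem card_clausesOn (V : Finset (Fin n)) :
    ((clausesOn q V).card : ℝ) = (V.card * (2 * q)) ^ 2 := by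
  classical
  have h := sum_literals_on V (fun _ : Fin q => (1 : ℝ))
  simp only [Finset.sum_const, Finset.card_univ, Fintype.card_fin, nsmul_eq_mul, mul_one] at h
  rw [clausesOn, ← Finset.sum_boole, sum_clauses]
  simp only [Matrix.cons_val_zero, Matrix.cons_val_one]
  rw [← h, pow_two, Finset.sum_mul_sum]
  refine Finset.sum_congr rfl fun a _ => Finset.sum_congr rfl fun b _ => ?_
  by_cases ha : a.1 ∈ V <;> by_cases hb : b.1 ∈ V <;> simp [ha, hb]

/-- The total number of conflicts of the literals of a list. -/
def totalWeight (A : List (GridLiteral n q)) : ℕ := (A.map GridLiteral.weight).sum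

open Classical in
theorem sum_conf (l : GridLiteral n q) :
    ∑ a : GridLiteral n q, (if Conf 1 l a then (1 : ℝ) else 0) = l.weight := by
  rw [Finset.sum_boole]
  have h : (Finset.univ.filter fun a : GridLiteral n q => Conf 1 l a) =
      ((Finset.univ.filter fun i' : Fin q => (l.2.2 : ℕ) + i' + 2 * 1 < q).map
        ⟨fun i' => (l.1, !l.2.1, i'), fun a b h => by simpa using h⟩) := by
    ext ⟨j, b, i⟩
    rw [Finset.mem_filter, Finset.mem_map]
    constructor
    · rintro ⟨-, rfl, h2, h3⟩
      refine ⟨i, Finset.mem_filter.2 ⟨Finset.mem_univ i, h3⟩, ?_⟩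
      change (l.1, !l.2.1, i) = (l.1, b, i)
      have hb : (!l.2.1) = b := by
        revert h2
        cases l.2.1 <;> cases b <;> simp
      rw [hb]
    · rintro ⟨i', h3, h⟩
      rw [← h]
      exact ⟨Finset.mem_univ _, rfl, (Bool.not_ne_self l.2.1).symm, (Finset.mem_filter.1 h3).2⟩
  rw [h, Finset.card_map, card_filter_add_lt]
  rfl

/-- The sum over the thresholds of the expected loss in the exponential of the weight. -/
noncomputable def gain (q : ℕ) (lam : ℝ) : ℝ :=
  ∑ i : Fin q, (1 - Real.exp (-(lam * (q - 2 - i : ℕ))))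

theorem one_sub_exp_nonneg {lam : ℝ} (hl : 0 ≤ lam) (k : ℕ) :
    0 ≤ 1 - Real.exp (-(lam * k)) := by
  rw [sub_nonneg, Real.exp_le_one_iff]
  have : 0 ≤ lam * k := by positivity
  linarith

theorem gain_nonneg {lam : ℝ} (hl : 0 ≤ lam) : 0 ≤ gain q lam :=
  Finset.sum_nonneg fun _ _ => one_sub_exp_nonneg hl _

theorem gain_le {lam : ℝ} : gain q lam ≤ q := by
  calc gain q lam ≤ ∑ _i : Fin q, (1 : ℝ) :=
        Finset.sum_le_sum fun i _ => by linarith [Real.exp_pos (-(lam * (q - 2 - i : ℕ)))]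
    _ = q := by simp

/-- A clause lowers the exponential if one literal conflicts with `l` (`l.weight` choices) and the
other is on a fresh variable of `V`, of which at least |V| - 1 - H remain. Two positions and two
relations give the factor 4; the sum over the thresholds is `gain`. -/
theorem sum_exp_newLits_le {lam : ℝ} (hl : 0 ≤ lam) {V : Finset (Fin n)} {l : GridLiteral n q}
    (hlV : l.1 ∈ V) (A : List (GridLiteral n q)) {H : ℕ} (hA : A.length ≤ H) :
    ∑ c ∈ clausesOn q V, Real.exp (-(lam * totalWeight (newLits l A c))) ≤
      (clausesOn q V).card - 4 * l.weight * (V.card - 1 - H) * gain q lam := by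
  classical
  set V' : Finset (Fin n) := (V.erase l.1) \ (A.map Prod.fst).toFinset with hV'
  have hcard : (V.card : ℝ) - 1 - H ≤ V'.card := by
    have h1 : (V.erase l.1).card - (A.map Prod.fst).toFinset.card ≤ V'.card :=
      Finset.le_card_sdiff _ _
    have h2 : (A.map Prod.fst).toFinset.card ≤ H :=
      (List.toFinset_card_le _).trans (by simpa using hA)
    have h3 := Finset.card_erase_of_mem hlV
    have h4 : V.card ≤ V'.card + 1 + H := by omega
    have h5 : (V.card : ℝ) ≤ V'.card + 1 + H := by exact_mod_cast h4
    linarith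
  set f : Fin q → ℝ := fun i => 1 - Real.exp (-(lam * (q - 2 - i : ℕ))) with hf
  set B : GridLiteral n q → ℝ := fun b => if b.1 ∈ V' then f b.2.2 else 0 with hB
  set E : GridLiteral n q → ℝ := fun a => if Conf 1 l a then 1 else 0 with hE
  have hf0 : ∀ i, 0 ≤ f i := fun i => one_sub_exp_nonneg hl _
  have hBsum : ∑ b, B b = V'.card * (2 * gain q lam) := sum_literals_on V' f
  have hEsum : ∑ a, E a = l.weight := sum_conf l
  -- The two products are never both nonzero, because a literal on a variable of `V'` cannot
  -- conflict with `l`. Inactive literals have weight 0 and contribute nothing.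
  have hpt : ∀ a b : GridLiteral n q, E a * B b + B a * E b ≤
      if a.1 ∈ V ∧ b.1 ∈ V then 1 - Real.exp (-(lam * totalWeight (newLits l A ![a, b])))
        else 0 := by
    intro a b
    have hnn : 0 ≤ if a.1 ∈ V ∧ b.1 ∈ V then
        1 - Real.exp (-(lam * totalWeight (newLits l A ![a, b]))) else 0 := by
      split_ifs
      · exact one_sub_exp_nonneg hl _
      · exact le_rfl
    have hfresh : ∀ b : GridLiteral n q, b.1 ∈ V' → b.1 ≠ l.1 ∧ b.1 ∈ V ∧
        b.1 ∉ A.map Prod.fst := by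
      intro b hb
      rw [hV', Finset.mem_sdiff, Finset.mem_erase, List.mem_toFinset] at hb
      exact ⟨hb.1.1, hb.1.2, hb.2⟩
    have hf1 : ∀ b : GridLiteral n q, ¬ b.Active → f b.2.2 = 0 := by
      intro b hb
      have : q - 2 - (b.2.2 : ℕ) = 0 := by
        unfold GridLiteral.Active at hb
        omega
      simp [hf, this]
    have hz : ∀ a b : GridLiteral n q, ¬ (Conf 1 l a ∧ b.1 ∈ V') → E a * B b = 0 := by
      intro a b h
      rcases not_and_or.1 h with h | h
      · simp only [hE, if_neg h, zero_mul]
      · simp only [hB, if_neg h, mul_zero]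
    by_cases h1 : Conf 1 l a ∧ b.1 ∈ V'
    · obtain ⟨hb1, hb2, hb3⟩ := hfresh b h1.2
      have h2 : ¬ Conf 1 l b := fun h => hb1 h.1.symm
      have h3 : a.1 ∈ V := h1.1.1 ▸ hlV
      have hEB : E a * B b + B a * E b = f b.2.2 := by
        simp only [hE, hB, if_pos h1.1, if_pos h1.2, if_neg h2, one_mul, mul_zero, add_zero]
      by_cases h4 : b.Active
      · have h5 : newLits l A ![a, b] = [b] := by
          unfold newLits
          rw [if_pos ⟨h1.1, hb1, hb3, h4⟩]
          rfl
        rw [hEB, if_pos ⟨h3, hb2⟩, h5]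
        simp [hf, totalWeight, GridLiteral.weight]
      · rw [hEB, hf1 b h4]
        exact hnn
    · by_cases h1' : Conf 1 l b ∧ a.1 ∈ V'
      · obtain ⟨hb1, hb2, hb3⟩ := hfresh a h1'.2
        have h2 : ¬ Conf 1 l a := fun h => hb1 h.1.symm
        have h3 : b.1 ∈ V := h1'.1.1 ▸ hlV
        have hEB : E a * B b + B a * E b = f a.2.2 := by
          simp only [hE, hB, if_pos h1'.1, if_pos h1'.2, if_neg h2, zero_mul, mul_one, zero_add]
        by_cases h4 : a.Active
        · have h5 : newLits l A ![a, b] = [a] := by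
            unfold newLits
            rw [if_neg (fun h => h2 h.1), if_pos ⟨h1'.1, hb1, hb3, h4⟩]
            rfl
          rw [hEB, if_pos ⟨hb2, h3⟩, h5]
          simp [hf, totalWeight, GridLiteral.weight]
        · rw [hEB, hf1 a h4]
          exact hnn
      · have hEB : E a * B b + B a * E b = 0 := by
          rw [hz a b h1, mul_comm, hz b a h1', add_zero]
        rw [hEB]
        exact hnn
  have htot : 2 * l.weight * (V'.card * (2 * gain q lam)) ≤
      ∑ c ∈ clausesOn q V, (1 - Real.exp (-(lam * totalWeight (newLits l A c)))) := by
    rw [clausesOn, Finset.sum_filter, sum_clauses]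
    refine le_trans (le_of_eq ?_) (Finset.sum_le_sum fun a _ => Finset.sum_le_sum fun b _ => hpt a b)
    simp only [Finset.sum_add_distrib, ← Finset.mul_sum, ← Finset.sum_mul, hBsum, hEsum]
    ring
  rw [Finset.sum_sub_distrib, Finset.sum_const, nsmul_eq_mul, mul_one] at htot
  have h6 : 4 * l.weight * (V.card - 1 - H) * gain q lam ≤
      2 * l.weight * (V'.card * (2 * gain q lam)) := by
    have := gain_nonneg (q := q) hl
    calc (4 * l.weight * (V.card - 1 - H) * gain q lam : ℝ)
        ≤ 4 * l.weight * V'.card * gain q lam := by gcongr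
      _ = _ := by ring
  linarith

end GrowthBound


/-! ### The supermartingale bound on extinction. -/

section GrowthInduction

variable {n q : ℕ}

open Classical in
/-- The indicator of the failure of the exploration. -/
noncomputable def failInd (H t : ℕ) (A : List (GridLiteral n q))
    (F : List (Fin 2 → GridLiteral n q)) : ℝ := if Fails H t A F then 1 else 0

theorem failInd_le_one (H t : ℕ) (A : List (GridLiteral n q))
    (F : List (Fin 2 → GridLiteral n q)) : failInd H t A F ≤ 1 := by
  unfold failInd
  split_ifs <;> simp

theorem failInd_eq_zero {H t : ℕ} {A : List (GridLiteral n q)}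
    {F : List (Fin 2 → GridLiteral n q)} (h : ¬ Fails H t A F) : failInd H t A F = 0 := if_neg h

theorem filter_not_touches (V : Finset (Fin n)) (j : Fin n) [DecidablePred (Touches (q := q) j)] :
    (clausesOn q V).filter (fun c => ¬ Touches j c) = clausesOn q (V.erase j) := by
  ext c
  rw [Finset.mem_filter, clausesOn, clausesOn, Finset.mem_filter, Finset.mem_filter,
    Finset.mem_erase, Finset.mem_erase, Touches]
  tauto

theorem newLits_of_not_touches {l : GridLiteral n q} (A : List (GridLiteral n q))
    {c : Fin 2 → GridLiteral n q} (h : ¬ Touches l.1 c) : newLits l A c = [] := by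
  rcases newLits_eq l A c with h' | ⟨s, -, hs, -⟩
  · exact h'
  · refine absurd ?_ h
    fin_cases s
    · exact Or.inr hs.1.symm
    · exact Or.inl hs.1.symm

theorem totalWeight_append (A B : List (GridLiteral n q)) :
    totalWeight (A ++ B) = totalWeight A + totalWeight B := by
  simp [totalWeight]

theorem totalWeight_nil : totalWeight ([] : List (GridLiteral n q)) = 0 := rfl

/-- One round, clause by clause: `u` clauses are unread and `k` are set aside. The set-aside clauses
range over all clauses on `V.erase l.1`, so `ih` applies once everything is read. In the second term
only set-aside clauses carry the tilt exp(-1). -/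
theorem listSum_scan_le {lam : ℝ} (hl : 0 ≤ lam) {V : Finset (Fin n)} {l : GridLiteral n q}
    (hlV : l.1 ∈ V) {H t M : ℕ} {D N N' g : ℝ} (hD : 0 ≤ D)
    (hN : N = (clausesOn q V).card) (hN' : N' = (clausesOn q (V.erase l.1)).card)
    (hg : g = 4 * l.weight * (V.card - 1 - H) * gain q lam) (hNg : 0 ≤ N - g)
    (ih : ∀ A : List (GridLiteral n q), Admissible l.1 A → (∀ l' ∈ A, l'.1 ∈ V) → ∀ k ≤ M,
      listSum (clausesOn q (V.erase l.1)) k (failInd H t A) ≤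
        Real.exp (-(lam * totalWeight A)) * N' ^ k + D * (N' * Real.exp (-1)) ^ k)
    (u k : ℕ) (huk : u + k ≤ M) (A : List (GridLiteral n q)) (hA : Admissible l.1 A)
    (hAV : ∀ l' ∈ A, l'.1 ∈ V) :
    listSum (clausesOn q V) u (fun U => listSum (clausesOn q (V.erase l.1)) k fun S =>
      failInd H t (scan l U A S).1 (scan l U A S).2) ≤
      Real.exp (-(lam * totalWeight A)) * (N - g) ^ u * N' ^ k +
        D * (N' * Real.exp (-1) + (N - N')) ^ u * (N' * Real.exp (-1)) ^ k := by
  classical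
  have hN'0 : 0 ≤ N' := by rw [hN']; positivity
  have hNN' : 0 ≤ N - N' := by
    rw [sub_nonneg, hN, hN', ← filter_not_touches V l.1]
    exact_mod_cast Finset.card_filter_le _ _
  induction u generalizing k A with
  | zero =>
    simpa only [listSum, scan, pow_zero, mul_one] using ih A hA hAV k (by omega)
  | succ u ihu =>
    -- A list of length `H` never fails, since scanning does not shorten it; otherwise the length
    -- bound needed by `sum_exp_newLits_le` holds.
    by_cases hAH : H ≤ A.length
    · refine le_trans (le_of_eq ?_) (show (0 : ℝ) ≤ _ by positivity)
      have h0 : ∀ U S, failInd H t (scan l U A S).1 (scan l U A S).2 = 0 := fun U S =>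
        failInd_eq_zero (not_fails_of_le_length t _ (hAH.trans (length_le_length_scan l U A S)))
      simp only [h0, listSum_const, mul_zero]
    · rw [listSum, ← Finset.sum_filter_add_sum_filter_not _ (fun c => Touches l.1 c)]
      set X : ℝ := (N - g) ^ u * N' ^ k with hX
      set Y : ℝ := D * (N' * Real.exp (-1) + (N - N')) ^ u * (N' * Real.exp (-1)) ^ k with hY
      have hX0 : 0 ≤ X := by positivity
      have h1 : ∑ c ∈ (clausesOn q V).filter (fun c => Touches l.1 c),
          listSum (clausesOn q V) u (fun U => listSum (clausesOn q (V.erase l.1)) k fun S =>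
            failInd H t (scan l (c :: U) A S).1 (scan l (c :: U) A S).2) ≤
          ∑ c ∈ (clausesOn q V).filter (fun c => Touches l.1 c),
            (Real.exp (-(lam * totalWeight A)) *
              Real.exp (-(lam * totalWeight (newLits l A c))) * X + Y) := by
        refine Finset.sum_le_sum fun c hc => ?_
        rw [Finset.mem_filter] at hc
        have hcV := (Finset.mem_filter.1 hc.1).2
        have h2 : ∀ U S, scan l (c :: U) A S = scan l U (newLits l A c ++ A) S := fun U S => by
          rw [scan, if_pos hc.2]
        simp only [h2]
        refine (ihu k (by omega) _ (hA.newLits_append c) ?_).trans_eq ?_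
        · intro l' hl'
          rcases List.mem_append.1 hl' with h | h
          · rcases newLits_eq l A c with h' | ⟨s, h', -⟩
            · simp [h'] at h
            · rw [h', List.mem_singleton] at h
              rw [h]
              fin_cases s
              · exact hcV.1
              · exact hcV.2
          · exact hAV l' h
        · rw [totalWeight_append, Nat.cast_add, mul_add, neg_add, Real.exp_add]
          ring
      have h3 : ∑ c ∈ (clausesOn q V).filter (fun c => ¬ Touches l.1 c),
          listSum (clausesOn q V) u (fun U => listSum (clausesOn q (V.erase l.1)) k fun S =>
            failInd H t (scan l (c :: U) A S).1 (scan l (c :: U) A S).2) ≤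
          Real.exp (-(lam * totalWeight A)) * (N' * X) + N' * Real.exp (-1) * Y := by
        have h4 : ∀ c ∈ (clausesOn q V).filter (fun c => ¬ Touches l.1 c),
            listSum (clausesOn q V) u (fun U => listSum (clausesOn q (V.erase l.1)) k fun S =>
              failInd H t (scan l (c :: U) A S).1 (scan l (c :: U) A S).2) =
            listSum (clausesOn q V) u (fun U => listSum (clausesOn q (V.erase l.1)) k fun S =>
              failInd H t (scan l U A (c :: S)).1 (scan l U A (c :: S)).2) := by
          intro c hc
          have h2 : ∀ U S, scan l (c :: U) A S = scan l U A (c :: S) := fun U S => by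
            rw [scan, if_neg (Finset.mem_filter.1 hc).2]
          simp only [h2]
        rw [Finset.sum_congr rfl h4, filter_not_touches, ← listSum_sum]
        refine (ihu (k + 1) (by omega) A hA hAV).trans_eq ?_
        rw [hX, hY]
        ring
      have h5 := sum_exp_newLits_le hl hlV A (H := H) (by omega)
      rw [← Finset.sum_filter_add_sum_filter_not _ (fun c => Touches l.1 c), filter_not_touches,
        ← hN, ← hg] at h5
      have h6 : ∑ c ∈ clausesOn q (V.erase l.1),
          Real.exp (-(lam * totalWeight (newLits l A c))) = N' := by
        rw [hN', ← filter_not_touches]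
        rw [Finset.sum_congr rfl (g := fun _ => (1 : ℝ))]
        · simp
        · intro c hc
          rw [newLits_of_not_touches A (Finset.mem_filter.1 hc).2, totalWeight_nil]
          simp
      have h7 : (((clausesOn q V).filter (fun c => Touches l.1 c)).card : ℝ) = N - N' := by
        rw [hN, hN', ← filter_not_touches V l.1, eq_sub_iff_add_eq]
        exact_mod_cast Finset.card_filter_add_card_filter_not _
      rw [h6] at h5
      refine (add_le_add h1 h3).trans ?_
      rw [Finset.sum_add_distrib, ← Finset.sum_mul, ← Finset.mul_sum, Finset.sum_const,
        nsmul_eq_mul, h7]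
      have h8 : Real.exp (-(lam * totalWeight A)) * X *
          (∑ c ∈ (clausesOn q V).filter (fun c => Touches l.1 c),
            Real.exp (-(lam * totalWeight (newLits l A c))) + N') ≤
          Real.exp (-(lam * totalWeight A)) * X * (N - g) := by gcongr
      calc _ = Real.exp (-(lam * totalWeight A)) * X *
          (∑ c ∈ (clausesOn q V).filter (fun c => Touches l.1 c),
            Real.exp (-(lam * totalWeight (newLits l A c))) + N') +
            (N' * Real.exp (-1) + (N - N')) * Y := by ring
        _ ≤ Real.exp (-(lam * totalWeight A)) * X * (N - g) +
            (N' * Real.exp (-1) + (N - N')) * Y := by linarith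
        _ = _ := by rw [hX, hY]; ring

/-- At most a fraction 2/v of the clauses touch a given variable, and dropping the tilt on them
costs a relative (e - 1)(2/v) ≤ 4/v. -/
theorem tilted_sum_le {v a N N' : ℝ} (hv : 1 ≤ v) (hN : N = (v * (2 * a)) ^ 2)
    (hN' : N' = ((v - 1) * (2 * a)) ^ 2) :
    0 ≤ N - N' ∧ N' * Real.exp (-1) + (N - N') ≤ N * Real.exp (-1) * Real.exp (4 / v) := by
  have hv0 : 0 < v := by linarith
  have ha : 0 ≤ 4 * a ^ 2 := by positivity
  have h1 : N - N' = 4 * a ^ 2 * (2 * v - 1) := by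
    rw [hN, hN']
    ring
  have h2 : N * (2 / v) = 4 * a ^ 2 * (2 * v) := by
    rw [hN]
    field_simp
    ring
  have h0 : 0 ≤ N - N' := by
    rw [h1]
    exact mul_nonneg ha (by linarith)
  refine ⟨h0, ?_⟩
  have h3 : N - N' ≤ N * (2 / v) := by
    rw [h1, h2]
    gcongr
    linarith
  have he : Real.exp 1 - 1 ≤ 2 := by
    have := Real.exp_one_lt_d9.le
    linarith
  have hee : Real.exp (-1) * Real.exp 1 = 1 := by rw [← Real.exp_add]; simp
  have h4 : 4 / v + 1 ≤ Real.exp (4 / v) := Real.add_one_le_exp (4 / v)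
  have h5 : 0 < Real.exp (-1) := Real.exp_pos _
  have hN0 : 0 ≤ N := by rw [hN]; positivity
  calc N' * Real.exp (-1) + (N - N')
      = Real.exp (-1) * (N + (Real.exp 1 - 1) * (N - N')) := by
        linear_combination (N' - N) * hee
    _ ≤ Real.exp (-1) * (N + 2 * (N * (2 / v))) := by gcongr
    _ = N * Real.exp (-1) * (4 / v + 1) := by ring
    _ ≤ _ := by gcongr

theorem tilted_pow_le {v a N N' C : ℝ} {k : ℕ} (hv : 1 ≤ v) (hN : N = (v * (2 * a)) ^ 2)
    (hN' : N' = ((v - 1) * (2 * a)) ^ 2) (hk : 4 * k ≤ C * v) :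
    (N' * Real.exp (-1) + (N - N')) ^ k ≤ Real.exp C * (N * Real.exp (-1)) ^ k := by
  obtain ⟨h1, h2⟩ := tilted_sum_le hv hN hN'
  have hv0 : 0 < v := by linarith
  have hN0 : 0 ≤ N := by rw [hN]; positivity
  have hN'0 : 0 ≤ N' := by rw [hN']; positivity
  calc (N' * Real.exp (-1) + (N - N')) ^ k
      ≤ (N * Real.exp (-1) * Real.exp (4 / v)) ^ k := by gcongr
    _ = Real.exp (k * (4 / v)) * (N * Real.exp (-1)) ^ k := by
      rw [mul_pow, ← Real.exp_nat_mul (4 / v), mul_comm]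
    _ ≤ _ := by
      gcongr
      rw [mul_div_assoc', div_le_iff₀ hv0]
      linarith

/-- With more than `μ` clauses available, the gain from newly forced literals pays for the weight
`w` of the processed literal. -/
theorem sub_pow_le_exp_mul {lam μ w g N Z : ℝ} {k : ℕ} (hl : 0 ≤ lam) (hμ : 0 < μ) (hN : 0 < N)
    (hg : g / N = w * Z) (hw : 0 ≤ w) (hgrow : lam ≤ μ * Z) (hk : μ < k) (hNg : 0 ≤ N - g) :
    (N - g) ^ k ≤ Real.exp (-(lam * w)) * N ^ k := by
  have hZ : 0 ≤ Z := nonneg_of_mul_nonneg_right (hl.trans hgrow) hμ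
  have h1 : N - g ≤ N * Real.exp (-(g / N)) := by
    have := Real.add_one_le_exp (-(g / N))
    calc N - g = N * (-(g / N) + 1) := by field_simp; ring
      _ ≤ _ := by gcongr
  have h2 : lam * w ≤ k * (g / N) := by
    rw [hg]
    calc lam * w ≤ μ * Z * w := by gcongr
      _ ≤ k * Z * w := by gcongr
      _ = _ := by ring
  calc (N - g) ^ k ≤ (N * Real.exp (-(g / N))) ^ k := by gcongr
    _ = Real.exp (-(k * (g / N))) * N ^ k := by
      rw [mul_pow, ← Real.exp_nat_mul, mul_comm]
      congr 2
      ring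
    _ ≤ _ := by gcongr

theorem sub_gain_nonneg {v a w h γ : ℝ} (hv : 1 ≤ v) (hw : 0 ≤ w) (hwa : w ≤ a) (hh : 0 ≤ h)
    (hγ : 0 ≤ γ) (hγa : γ ≤ a) : 0 ≤ (v * (2 * a)) ^ 2 - 4 * w * (v - 1 - h) * γ := by
  have ha : 0 ≤ a := hw.trans hwa
  have h1 : 4 * w * (v - 1 - h) * γ ≤ 4 * w * v * γ := by
    gcongr
    linarith
  have h2 : 4 * w * v * γ ≤ 4 * a * v * a := by gcongr
  have h3 : 4 * a * v * a ≤ (v * (2 * a)) ^ 2 := by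
    have : 0 ≤ 4 * a ^ 2 * v := by positivity
    nlinarith
  linarith

/-- The first term is the exponential supermartingale in the weight of the unprocessed literals;
`hgrow` says that the process is supercritical on every variable set that can occur. The second term
pays for running out of clauses: if k ≤ μ, then 1 ≤ exp(μ - k), and each round costs a further
factor exp(C) because the clauses it uses up lose their tilt. Each round removes one variable from
`V`, hence the bound `v₀ + t`. -/
theorem listSum_failInd_le [NeZero q] {lam : ℝ} (hl : 0 ≤ lam) {H v₀ M : ℕ} {C μ : ℝ}
    (hv₀ : 0 < v₀) (hC : 4 * M ≤ C * v₀) (hC0 : 0 ≤ C) (hμ : 0 < μ)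
    (hgrow : ∀ v : ℕ, v₀ ≤ v → v ≤ n →
      lam ≤ μ * ((((v : ℝ) - 1 - H) / v) * (gain q lam / (q ^ 2 * v))))
    (t : ℕ) (V : Finset (Fin n)) (hV : v₀ + t ≤ V.card) (A : List (GridLiteral n q))
    (hnd : (A.map Prod.fst).Nodup) (hact : ∀ l ∈ A, l.Active) (hAV : ∀ l ∈ A, l.1 ∈ V)
    (k : ℕ) (hk : k ≤ M) :
    listSum (clausesOn q V) k (failInd H t A) ≤
      Real.exp (-(lam * totalWeight A)) * ((clausesOn q V).card : ℝ) ^ k +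
        Real.exp (C * t + μ) * ((clausesOn q V).card * Real.exp (-1)) ^ k := by
  induction t generalizing V A k with
  | zero =>
    have h0 : ∀ F, failInd H 0 A F = 0 := fun F => failInd_eq_zero (by simp [Fails])
    have h1 : listSum (clausesOn q V) k (failInd H 0 A) = 0 := by
      rw [show failInd H 0 A = fun _ => 0 from funext h0, listSum_const, mul_zero]
    rw [h1]
    positivity
  | succ t ih =>
    set N : ℝ := ((clausesOn q V).card : ℝ) with hN
    have hN0 : 0 ≤ N := by positivity
    have htriv : listSum (clausesOn q V) k (failInd H (t + 1) A) ≤ N ^ k :=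
      (listSum_mono _ _ fun F => failInd_le_one H (t + 1) A F).trans_eq (by
        rw [listSum_const, mul_one])
    by_cases hkμ : (k : ℝ) ≤ μ
    · refine htriv.trans ?_
      have h1 : N ^ k ≤ Real.exp (C * (t + 1 : ℕ) + μ) * (N * Real.exp (-1)) ^ k := by
        rw [mul_pow, ← Real.exp_nat_mul, mul_left_comm, ← Real.exp_add]
        refine le_mul_of_one_le_right (by positivity) (Real.one_le_exp ?_)
        have : 0 ≤ C * (t + 1 : ℕ) := by positivity
        linarith
      have h2 : 0 ≤ Real.exp (-(lam * totalWeight A)) * N ^ k := by positivity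
      linarith
    · cases A with
      | nil =>
        refine htriv.trans ?_
        have h2 : 0 ≤ Real.exp (C * (t + 1 : ℕ) + μ) * (N * Real.exp (-1)) ^ k := by positivity
        simp only [totalWeight_nil, Nat.cast_zero, mul_zero, neg_zero, Real.exp_zero, one_mul]
        linarith
      | cons l A =>
        have hlV : l.1 ∈ V := hAV l List.mem_cons_self
        have hA : Admissible l.1 A := by
          rw [List.map_cons, List.nodup_cons] at hnd
          exact ⟨hnd.2, hnd.1, fun l' hl' => hact l' (List.mem_cons_of_mem _ hl')⟩
        have hAV' : ∀ l' ∈ A, l'.1 ∈ V := fun l' hl' => hAV l' (List.mem_cons_of_mem _ hl')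
        set v : ℝ := (V.card : ℝ) with hv
        have hv0 : 0 < v := by
          rw [hv]
          exact_mod_cast (by omega : 0 < V.card)
        have hv0' : (v₀ : ℝ) ≤ v := by
          rw [hv]
          exact_mod_cast (by omega : v₀ ≤ V.card)
        have hv₀' : (0 : ℝ) < v₀ := by exact_mod_cast hv₀
        have hq : (0 : ℝ) < q := by exact_mod_cast NeZero.pos q
        have hNv : N = (v * (2 * q)) ^ 2 := card_clausesOn V
        have hNpos : 0 < N := by rw [hNv]; positivity
        have hVe : ((V.erase l.1).card : ℝ) = v - 1 := by
          rw [Finset.card_erase_of_mem hlV, Nat.cast_sub (by omega), Nat.cast_one]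
        set N' : ℝ := ((clausesOn q (V.erase l.1)).card : ℝ) with hN'
        have hNv' : N' = ((v - 1) * (2 * q)) ^ 2 := by
          rw [hN', card_clausesOn, hVe]
        set g : ℝ := 4 * l.weight * (V.card - 1 - H) * gain q lam with hg
        have hgain := gain_nonneg (q := q) hl
        have hw : (l.weight : ℝ) ≤ q := by
          have : l.weight ≤ q := by unfold GridLiteral.weight; omega
          exact_mod_cast this
        have hv1 : 1 ≤ v := by
          rw [hv]
          exact_mod_cast (by omega : 1 ≤ V.card)
        have hNg : 0 ≤ N - g := by
          rw [hNv, hg]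
          exact sub_gain_nonneg hv1 (Nat.cast_nonneg _) hw (Nat.cast_nonneg _) hgain gain_le
        have hD : 0 ≤ Real.exp (C * t + μ) := (Real.exp_pos _).le
        have hmain := listSum_scan_le hl hlV (t := t) (M := M) hD hN hN' hg hNg
          (fun A' hA' hAV2 k' hk' => ih (V.erase l.1) (by
            rw [Finset.card_erase_of_mem hlV]
            omega) A' hA'.1 hA'.2.2 (fun l' hl' => Finset.mem_erase.2 ⟨fun he => hA'.2.1
              (he ▸ List.mem_map_of_mem hl'), hAV2 l' hl'⟩) k' hk') k 0 hk A hA hAV'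
        simp only [listSum, pow_zero, mul_one] at hmain
        have hle : listSum (clausesOn q V) k (failInd H (t + 1) (l :: A)) ≤
            listSum (clausesOn q V) k fun U => failInd H t (scan l U A []).1 (scan l U A []).2 := by
          refine listSum_mono _ _ fun F => ?_
          unfold failInd
          by_cases h : Fails H (t + 1) (l :: A) F
          · rw [if_pos h, if_pos h.2]
          · rw [if_neg h]
            split_ifs <;> simp
        refine hle.trans (hmain.trans ?_)
        push Not at hkμ
        have hfirst : (N - g) ^ k ≤ Real.exp (-(lam * l.weight)) * N ^ k := by
          have hgn := hgrow V.card (by omega) (by simpa using Finset.card_le_univ V)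
          refine sub_pow_le_exp_mul hl hμ hNpos ?_ (Nat.cast_nonneg _) hgn hkμ hNg
          rw [hg, hNv, ← hv]
          field_simp
          ring
        have hsecond : (N' * Real.exp (-1) + (N - N')) ^ k ≤
            Real.exp C * (N * Real.exp (-1)) ^ k := by
          refine tilted_pow_le hv1 hNv hNv' ?_
          have hkM : (k : ℝ) ≤ M := by exact_mod_cast hk
          nlinarith
        have hW : Real.exp (-(lam * totalWeight (l :: A))) =
            Real.exp (-(lam * totalWeight A)) * Real.exp (-(lam * l.weight)) := by
          rw [← Real.exp_add]
          congr 1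
          simp only [totalWeight, List.map_cons, List.sum_cons, Nat.cast_add]
          ring
        have hE : Real.exp (C * (t + 1 : ℕ) + μ) = Real.exp (C * t + μ) * Real.exp C := by
          rw [← Real.exp_add]
          congr 1
          push_cast
          ring
        rw [hW, hE, mul_assoc, mul_assoc]
        gcongr

end GrowthInduction


/-! ### Second moment method for hitting disjoint events. -/

section SecondMoment

theorem prob_forall {γ Λ : Type*} [Fintype γ] [DecidableEq γ] [Fintype Λ] (P : γ → Λ → Prop) :
    prob (fun ω : γ → Λ => ∀ g, P g (ω g)) = ∏ g, prob (P g) := by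
  classical
  unfold prob
  rw [← avg_pi]
  congr 1
  funext ω
  rw [Finset.prod_ite_zero]
  simp

theorem prob_not {Ω : Type*} [Fintype Ω] [Nonempty Ω] (S : Ω → Prop) :
    prob (fun ω => ¬ S ω) = 1 - prob S := by
  classical
  unfold prob
  rw [← avg_const (Ω := Ω) 1, ← avg_sub, avg_const]
  congr 1
  funext ω
  by_cases h : S ω <;> simp [h]

/-- For exposing independent batches of clauses one after the other. -/
theorem prob_prod_le_add {Ω Ω' : Type*} [Fintype Ω] [Fintype Ω'] [Nonempty Ω] [Nonempty Ω']
    (S : Ω × Ω' → Prop) (bad : Ω → Prop) {ε : ℝ} (hε : 0 ≤ ε)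
    (h : ∀ a, ¬ bad a → prob (fun b => S (a, b)) ≤ ε) : prob S ≤ prob bad + ε := by
  calc prob S ≤ prob (fun ω : Ω × Ω' => bad ω.1 ∨ (¬ bad ω.1 ∧ S ω)) :=
        prob_mono fun ω hω => by tauto
    _ ≤ prob (fun ω : Ω × Ω' => bad ω.1) + prob (fun ω : Ω × Ω' => ¬ bad ω.1 ∧ S ω) :=
        prob_or_le _ _
    _ ≤ prob bad + ε := by
        rw [prob_fst]
        gcongr
        refine prob_prod_le _ fun a => ?_
        by_cases ha : bad a
        · refine le_trans (prob_mono (T := fun _ => False) fun b hb => hb.1 ha) ?_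
          simpa [prob, avg] using hε
        · exact (prob_mono fun b hb => hb.2).trans (h a ha)

variable {γ J Λ : Type*} [Fintype γ] [DecidableEq γ] [Fintype J] [Fintype Λ] [Nonempty Λ]

theorem prob_hit (P : Λ → Prop) (M : ℕ) :
    prob (fun L : Fin M → Λ => ∃ i, P (L i)) = 1 - (1 - prob P) ^ M := by
  have h1 : prob (fun L : Fin M → Λ => ¬ ∀ i, ¬ P (L i)) = 1 - (1 - prob P) ^ M := by
    rw [prob_not, prob_forall (fun _ : Fin M => fun c => ¬ P c), Finset.prod_const, prob_not,
      Finset.card_univ, Fintype.card_fin]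
  rw [← h1]
  simp only [not_forall, not_not]

/-- Hits of disjoint events are negatively correlated: by inclusion–exclusion this reduces to 1 - 2p
≤ (1 - p)². -/
theorem prob_hit_and_le (P P' : Λ → Prop) (M : ℕ) (hPP' : ∀ c, P c → ¬ P' c)
    (he : prob P' = prob P) :
    prob (fun L : Fin M → Λ => (∃ i, P (L i)) ∧ ∃ i, P' (L i)) ≤ (1 - (1 - prob P) ^ M) ^ 2 := by
  classical
  have h1 : prob (fun c => P c ∨ P' c) = 2 * prob P := by
    rw [two_mul]
    nth_rewrite 2 [← he]
    unfold prob
    rw [← avg_add]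
    congr 1
    funext c
    by_cases h : P c
    · simp [h, hPP' c h]
    · by_cases h' : P' c <;> simp [h, h']
  have h2 : prob (fun L : Fin M → Λ => ∃ i, P (L i) ∨ P' (L i)) = 1 - (1 - 2 * prob P) ^ M := by
    rw [prob_hit (fun c => P c ∨ P' c), h1]
  have h3 : prob (fun L : Fin M → Λ => (∃ i, P (L i)) ∧ ∃ i, P' (L i)) +
      prob (fun L : Fin M → Λ => ∃ i, P (L i) ∨ P' (L i)) =
      prob (fun L : Fin M → Λ => ∃ i, P (L i)) + prob (fun L : Fin M → Λ => ∃ i, P' (L i)) := by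
    simp only [exists_or]
    unfold prob
    rw [← avg_add, ← avg_add]
    congr 1
    funext L
    by_cases h : ∃ i, P (L i) <;> by_cases h' : ∃ i, P' (L i) <;> simp only [h, h'] <;> norm_num
  rw [h2, prob_hit P, prob_hit P', he] at h3
  have h4 : 2 * prob P ≤ 1 := by
    rw [← h1]
    exact prob_le_one _
  have h5 : (1 - 2 * prob P) ^ M ≤ ((1 - prob P) ^ M) ^ 2 := by
    refine (pow_le_pow_left₀ (by linarith) ?_ M).trans_eq (pow_right_comm (1 - prob P) 2 M)
    linarith [sq_nonneg (prob P), sub_sq 1 (prob P)]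
  linarith [sub_sq 1 ((1 - prob P) ^ M)]

/-- If each of several samples of size `M` contains a given member of a family of disjoint events
with probability `π g`, then some member of the family is met by all samples, with high
probability. -/
theorem prob_forall_not_hit_le (M : ℕ) (hit : γ → J → Λ → Prop)
    (hdisj : ∀ g j j' c, j ≠ j' → hit g j c → ¬ hit g j' c) (p : γ → ℝ)
    (hp : ∀ g j, prob (hit g j) = p g)
    (hpos : 0 < (Fintype.card J : ℝ) * ∏ g, (1 - (1 - p g) ^ M)) :
    prob (fun ω : γ → Fin M → Λ => ∀ j, ¬ ∀ g, ∃ i, hit g j (ω g i)) ≤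
      1 / ((Fintype.card J : ℝ) * ∏ g, (1 - (1 - p g) ^ M)) := by
  classical
  set π : ℝ := ∏ g, (1 - (1 - p g) ^ M) with hπ
  set μ : ℝ := (Fintype.card J : ℝ) * π with hμ
  let Z : J → (γ → Fin M → Λ) → ℝ := fun j ω => if ∀ g, ∃ i, hit g j (ω g i) then 1 else 0
  let X : (γ → Fin M → Λ) → ℝ := fun ω => ∑ j, Z j ω
  have hZ : ∀ j, avg (Z j) = π := by
    intro j
    have h := prob_forall (fun (g : γ) (L : Fin M → Λ) => ∃ i, hit g j (L i))
    simp only [prob_hit, hp] at h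
    rw [hπ, ← h]
    unfold prob
    congr 1
    funext ω
    simp only [Z]
    congr
  have hZZ : ∀ j j', j ≠ j' → avg (fun ω => Z j ω * Z j' ω) ≤ π ^ 2 := by
    intro j j' hjj'
    have h := prob_forall (fun (g : γ) (L : Fin M → Λ) => (∃ i, hit g j (L i)) ∧
      ∃ i, hit g j' (L i))
    have h1 : avg (fun ω => Z j ω * Z j' ω) = prob (fun ω : γ → Fin M → Λ =>
        ∀ g, (∃ i, hit g j (ω g i)) ∧ ∃ i, hit g j' (ω g i)) := by
      unfold prob
      congr 1
      funext ω
      simp only [Z, forall_and]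
      by_cases ha : ∀ g, ∃ i, hit g j (ω g i) <;> by_cases hb : ∀ g, ∃ i, hit g j' (ω g i) <;>
        simp only [ha, hb] <;> norm_num
    rw [h1, h, hπ, ← Finset.prod_pow]
    refine Finset.prod_le_prod (fun g _ => prob_nonneg _) fun g _ => ?_
    rw [← hp g j]
    exact prob_hit_and_le _ _ M (fun c => hdisj g j j' c hjj') (by rw [hp, hp])
  have hEX : avg X = μ := by
    simp only [X]
    rw [avg_sum]
    simp only [hZ, Finset.sum_const, Finset.card_univ, nsmul_eq_mul]
    exact hμ.symm
  have hEX2 : avg (fun ω => X ω * X ω) ≤ μ + μ ^ 2 := by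
    simp only [X, Finset.sum_mul_sum]
    rw [avg_sum]
    simp only [avg_sum]
    calc ∑ j, ∑ j', avg (fun ω => Z j ω * Z j' ω)
        ≤ ∑ j, ∑ j', ((if j = j' then π else 0) + π ^ 2) := by
          refine Finset.sum_le_sum fun j _ => Finset.sum_le_sum fun j' _ => ?_
          split_ifs with h
          · subst h
            have : (fun ω => Z j ω * Z j ω) = Z j := by
              funext ω
              simp only [Z]
              split_ifs <;> simp
            rw [this, hZ]
            nlinarith [sq_nonneg π]
          · rw [zero_add]
            exact hZZ j j' h
      _ = μ + μ ^ 2 := by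
          simp only [Finset.sum_add_distrib, Finset.sum_ite_eq, Finset.mem_univ, if_true,
            Finset.sum_const, Finset.card_univ, nsmul_eq_mul]
          rw [hμ]
          ring
  -- Chebyshev: (X - μ)² equals μ² where X = 0, and the variance is at most μ.
  have hvar : μ ^ 2 * prob (fun ω : γ → Fin M → Λ => ∀ j, ¬ ∀ g, ∃ i, hit g j (ω g i)) ≤ μ := by
    unfold prob
    rw [← avg_mul_left]
    calc _ ≤ avg (fun ω => (X ω * X ω - (2 * μ) * X ω) + μ ^ 2) := by
          refine avg_mono fun ω => ?_
          split_ifs with h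
          · have : X ω = 0 := by
              simp only [X, Z]
              exact Finset.sum_eq_zero fun j _ => if_neg (h j)
            rw [this]
            linarith
          · nlinarith [sq_nonneg (X ω - μ)]
      _ = avg (fun ω => X ω * X ω) - 2 * μ * μ + μ ^ 2 := by
          rw [avg_add, avg_sub, avg_mul_left, avg_const, hEX]
      _ ≤ μ := by linarith
  rw [le_div_iff₀ hpos]
  have h9 : μ * (prob (fun ω : γ → Fin M → Λ => ∀ j, ¬ ∀ g, ∃ i, hit g j (ω g i)) * μ) ≤ μ * 1 := by
    linarith
  exact le_of_mul_le_mul_left h9 hpos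

end SecondMoment


/-! ### Seeds, and the unsatisfiability bound from three batches of clauses. -/

section Seeds

variable {n q : ℕ}

theorem prob_fails_le [NeZero n] [NeZero q] {lam : ℝ} (hl : 0 ≤ lam) {H v₀ M t : ℕ} {C μ : ℝ}
    (hv₀ : 0 < v₀) (hC : 4 * M ≤ C * v₀) (hC0 : 0 ≤ C) (hμ : 0 < μ)
    (hgrow : ∀ v : ℕ, v₀ ≤ v → v ≤ n →
      lam ≤ μ * ((((v : ℝ) - 1 - H) / v) * (gain q lam / (q ^ 2 * v))))
    (ht : v₀ + t ≤ n) (A : List (GridLiteral n q))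
    (hnd : (A.map Prod.fst).Nodup) (hact : ∀ l ∈ A, l.Active) :
    prob (fun F : Fin M → Fin 2 → GridLiteral n q => Fails H t A (List.ofFn F)) ≤
      Real.exp (-(lam * totalWeight A)) + Real.exp (C * t + μ - M) := by
  classical
  have h := listSum_failInd_le hl hv₀ hC hC0 hμ hgrow t Finset.univ (by simpa using ht) A hnd hact
    (fun _ _ => Finset.mem_univ _) M le_rfl
  have h1 : clausesOn q (Finset.univ : Finset (Fin n)) = Finset.univ := by
    simp [clausesOn]
  rw [h1, listSum_ofFn, Finset.card_univ] at h
  have h2 : (0 : ℝ) < Fintype.card (Fin 2 → GridLiteral n q) := by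
    exact_mod_cast Fintype.card_pos
  have h3 : prob (fun F : Fin M → Fin 2 → GridLiteral n q => Fails H t A (List.ofFn F)) =
      (∑ F : Fin M → Fin 2 → GridLiteral n q, failInd H t A (List.ofFn F)) /
        (Fintype.card (Fin 2 → GridLiteral n q) : ℝ) ^ M := by
    rw [prob, avg]
    congr 1
    rw [Fintype.card_fun, Fintype.card_fin, Nat.cast_pow]
  rw [h3, div_le_iff₀ (by positivity)]
  refine h.trans_eq ?_
  rw [mul_pow, ← Real.exp_nat_mul, add_mul, sub_eq_add_neg, Real.exp_add _ (-(M : ℝ))]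
  ring_nf

theorem prob_seed_clause [NeZero n] [NeZero q] (j : Fin n) (σ : Bool) (B : Finset (Fin n)) :
    prob (fun c : Fin 2 → GridLiteral n q => c 0 = (j, σ, 0) ∧ (c 1).1 ∈ B ∧ (c 1).2.2 = 0) =
      B.card / (2 * q ^ 2 * n ^ 2) := by
  classical
  have h := prob_forall (fun (s : Fin 2) (a : GridLiteral n q) =>
    if s = 0 then a = (j, σ, 0) else a.1 ∈ B ∧ a.2.2 = 0)
  simp only [Fin.forall_fin_two, Fin.prod_univ_two, if_true, one_ne_zero, if_false] at h
  rw [h]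
  have hcard : (Fintype.card (GridLiteral n q) : ℝ) = n * (2 * q) := by
    simp [GridLiteral]
  have h1 : prob (fun a : GridLiteral n q => a = (j, σ, 0)) = 1 / (n * (2 * q)) := by
    rw [prob, avg, hcard, Finset.sum_eq_single (j, σ, 0)]
    · simp
    · exact fun a _ ha => if_neg ha
    · simp
  have h2 : prob (fun a : GridLiteral n q => a.1 ∈ B ∧ a.2.2 = 0) =
      B.card * 2 / (n * (2 * q)) := by
    have h3 := sum_literals_on (q := q) B (fun i => if i = 0 then 1 else 0)
    rw [prob, avg, hcard]
    congr 1
    simp only [Finset.sum_ite_eq', Finset.mem_univ, if_true, mul_one] at h3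
    rw [← h3]
    refine Finset.sum_congr rfl fun a _ => ?_
    by_cases ha : a.1 ∈ B <;> by_cases hb : a.2.2 = 0 <;> simp [ha, hb]
  rw [h1, h2]
  have hn : (n : ℝ) ≠ 0 := by exact_mod_cast NeZero.ne n
  have hq : (q : ℝ) ≠ 0 := by exact_mod_cast NeZero.ne q
  field_simp

/-- The clauses that are hit at `j` provide, for each value of `x j`, a list of forced literals on
distinct variables. -/
theorem exists_seeds [NeZero q] (hq : 3 ≤ q) {K M : ℕ} {B : Fin K → Finset (Fin n)}
    (hB : ∀ k k', k ≠ k' → Disjoint (B k) (B k'))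
    (ω : Bool × Fin K → Fin M → Fin 2 → GridLiteral n q) (j : Fin n)
    (h : ∀ g, ∃ i, ω g i 0 = (j, g.1, 0) ∧ (ω g i 1).1 ∈ B g.2 ∧ (ω g i 1).2.2 = 0) :
    ∃ A : Bool → List (GridLiteral n q), (∀ σ, ((A σ).map Prod.fst).Nodup) ∧
      (∀ σ, ∀ l ∈ A σ, l.Active) ∧ (∀ σ, totalWeight (A σ) = K * (q - 2)) ∧
      ∀ x : Fin n → unitInterval, (∀ g i, ∃ s, (ω g i s).Holds 1 x) →
        ∃ σ, ∀ l ∈ A σ, l.Holds 1 x := by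
  choose i hi0 hi1 hi2 using h
  refine ⟨fun σ => List.ofFn fun k => ω (σ, k) (i (σ, k)) 1, fun σ => ?_, fun σ l hl => ?_,
    fun σ => ?_, fun x hx => ?_⟩
  · rw [List.map_ofFn, List.nodup_ofFn]
    intro k k' hkk'
    by_contra hne
    simp only [Function.comp_apply] at hkk'
    have h1 := hi1 (σ, k)
    have h2 := hi1 (σ, k')
    rw [hkk'] at h1
    exact Finset.disjoint_left.1 (hB k k' hne) h1 h2
  · obtain ⟨k, rfl⟩ := (List.mem_ofFn' _ _).1 hl
    rw [GridLiteral.Active, hi2, Fin.val_zero]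
    omega
  · rw [totalWeight, List.map_ofFn, List.sum_ofFn]
    simp [GridLiteral.weight, hi2]
  · have hq0 : (0 : ℝ) < q := by exact_mod_cast NeZero.pos q
    have hq3 : (3 : ℝ) ≤ q := by exact_mod_cast hq
    -- For q ≥ 3 no value is both at most 1/q and at least 1 - 1/q. The literal that fails forces
    -- the other literal of each of its `K` seed clauses.
    have hσ : ∃ σ : Bool, ¬ GridLiteral.Holds 1 x ((j, σ, 0) : GridLiteral n q) := by
      by_cases hj : (x j : ℝ) ≤ 1 / q
      · refine ⟨false, ?_⟩
        simp only [GridLiteral.Holds, Fin.val_zero, Nat.cast_zero, zero_add, Nat.cast_one, not_le]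
        have : (1 : ℝ) / q ≤ 1 / 3 := one_div_le_one_div_of_le (by norm_num) hq3
        linarith
      · refine ⟨true, ?_⟩
        simpa only [GridLiteral.Holds, Fin.val_zero, Nat.cast_zero, zero_add, Nat.cast_one] using hj
    obtain ⟨σ, hσ⟩ := hσ
    refine ⟨σ, fun l hl => ?_⟩
    obtain ⟨k, rfl⟩ := (List.mem_ofFn' _ _).1 hl
    obtain ⟨s, hs⟩ := hx (σ, k) (i (σ, k))
    have h2 : ∀ s : Fin 2, s = 0 ∨ s = 1 := by decide
    rcases h2 s with rfl | rfl
    · rw [hi0] at hs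
      exact absurd hs hσ
    · exact hs

/-- A clause in conflict with the literals of a long list appears soon. -/
theorem prob_no_conflicting_clause_le [NeZero n] [NeZero q] {H : ℕ} (T : List (GridLiteral n q))
    (hnd : (T.map Prod.fst).Nodup) (hact : ∀ l ∈ T, l.Active) (hH : H ≤ T.length) (M : ℕ) :
    prob (fun F : Fin M → Fin 2 → GridLiteral n q => ∃ x : Fin n → unitInterval,
      (∀ i, ∃ s, (F i s).Holds 1 x) ∧ ∀ l ∈ T, l.Holds 1 x) ≤
      (1 - ((H : ℝ) / (n * (2 * q))) ^ 2) ^ M := by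
  classical
  obtain ⟨P, hP⟩ : ∃ P : GridLiteral n q → Prop, ∀ a, P a ↔ ∃ l ∈ T, Conf 1 l a :=
    ⟨_, fun _ => Iff.rfl⟩
  have h1 : (H : ℝ) / (n * (2 * q)) ≤ prob P := by
    rw [prob_eq_card_div]
    have hcard : (Fintype.card (GridLiteral n q) : ℝ) = n * (2 * q) := by
      simp [GridLiteral]
    rw [hcard]
    gcongr
    -- An active literal conflicts with the opposite literal of index 0; distinct variables make
    -- these witnesses distinct.
    have h2 : (T.map fun l => ((l.1, !l.2.1, 0) : GridLiteral n q)).Nodup := by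
      refine List.Nodup.of_map Prod.fst ?_
      rw [List.map_map]
      exact hnd
    refine hH.trans ?_
    rw [← List.length_map (fun l => ((l.1, !l.2.1, 0) : GridLiteral n q)),
      ← List.toFinset_card_of_nodup h2]
    refine Finset.card_le_card fun a ha => ?_
    rw [List.mem_toFinset, List.mem_map] at ha
    obtain ⟨l, hl, rfl⟩ := ha
    refine Finset.mem_filter.2 ⟨Finset.mem_univ _, (hP _).2 ⟨l, hl, rfl, (Bool.not_ne_self l.2.1).symm, ?_⟩⟩
    have := hact l hl
    simpa [GridLiteral.Active] using this
  have h2 : prob (fun c : Fin 2 → GridLiteral n q => ∀ s, P (c s)) = prob P ^ 2 := by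
    rw [prob_forall (fun (_ : Fin 2) => P)]
    simp
  have h3 : prob (fun F : Fin M → Fin 2 → GridLiteral n q => ∀ i, ¬ ∀ s, P (F i s)) =
      (1 - prob P ^ 2) ^ M := by
    rw [prob_forall (fun (_ : Fin M) (c : Fin 2 → GridLiteral n q) => ¬ ∀ s, P (c s)),
      Finset.prod_const, prob_not, h2, Finset.card_univ, Fintype.card_fin]
  refine (prob_mono fun F hF i hi => ?_).trans (h3.le.trans ?_)
  · obtain ⟨x, hx, hT⟩ := hF
    obtain ⟨s, hs⟩ := hx i
    obtain ⟨l, hl, hc⟩ := (hP _).1 (hi s)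
    exact hc.not_holds (hT l hl) hs
  · have h4 := prob_le_one P
    have h5 := prob_nonneg P
    gcongr
    nlinarith

/-- The families indexed by a sum of three finite types, as triples of families. -/
def sumArrowEquiv (γ ι₁ ι₂ ι₃ X : Type*) :
    ((γ × ι₁) ⊕ (ι₂ ⊕ ι₃) → X) ≃ (γ → ι₁ → X) × (ι₂ → X) × (ι₃ → X) :=
  (Equiv.sumArrowEquivProdArrow _ _ _).trans
    ((Equiv.curry _ _ _).prodCongr (Equiv.sumArrowEquivProdArrow _ _ _))

/-- The summands bound, in turn, the absence of a fully seeded variable, extinction from the seeds,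
shortage of clauses in the exploration, and the absence of a conflicting clause at the end. The
factors 2 account for the two possible failing literals at the seeded variable. -/
theorem prob_gridSat_le [NeZero n] [NeZero q] (hq : 3 ≤ q) {lam : ℝ} (hl : 0 ≤ lam)
    {m K M₁ M₂ M₃ H v₀ b : ℕ} {C μ : ℝ} (hm : 2 * K * M₁ + M₂ + M₃ ≤ m) (hb : K * b ≤ n)
    (hb0 : 0 < b) (hM₁ : 0 < M₁) (hv₀ : 0 < v₀) (hC : 4 * M₂ ≤ C * v₀) (hC0 : 0 ≤ C) (hμ : 0 < μ)
    (hgrow : ∀ v : ℕ, v₀ ≤ v → v ≤ n →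
      lam ≤ μ * ((((v : ℝ) - 1 - H) / v) * (gain q lam / (q ^ 2 * v))))
    (hH : v₀ + H ≤ n) :
    prob (fun G : GridFormula n q m => GridSat 1 G) ≤
      1 / (n * (1 - (1 - (b : ℝ) / (2 * q ^ 2 * n ^ 2)) ^ M₁) ^ (2 * K)) +
      (2 * (Real.exp (-(lam * (K * (q - 2) : ℕ))) + Real.exp (C * H + μ - M₂)) +
      2 * (1 - ((H : ℝ) / (n * (2 * q))) ^ 2) ^ M₃) := by
  classical
  have hcard : Fintype.card (((Bool × Fin K) × Fin M₁) ⊕ (Fin M₂ ⊕ Fin M₃)) ≤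
      Fintype.card (Fin m) := by
    simp only [Fintype.card_sum, Fintype.card_prod, Fintype.card_bool, Fintype.card_fin]
    omega
  obtain ⟨e⟩ := Function.Embedding.nonempty_of_card_le hcard
  let S : (Bool × Fin K → Fin M₁ → Fin 2 → GridLiteral n q) ×
      (Fin M₂ → Fin 2 → GridLiteral n q) × (Fin M₃ → Fin 2 → GridLiteral n q) → Prop :=
    fun ω => ∃ x : Fin n → unitInterval, (∀ g i, ∃ s, (ω.1 g i s).Holds 1 x) ∧
      (∀ i, ∃ s, (ω.2.1 i s).Holds 1 x) ∧ ∀ i, ∃ s, (ω.2.2 i s).Holds 1 x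
  have hS : prob (fun G : GridFormula n q m => GridSat 1 G) ≤ prob S := by
    rw [← prob_equiv (sumArrowEquiv (Bool × Fin K) (Fin M₁) (Fin M₂) (Fin M₃) _) S,
      ← prob_comp_injective e.injective]
    refine prob_mono fun G hG => ?_
    obtain ⟨x, hx⟩ := hG
    exact ⟨x, fun g i => hx _, fun i => hx _, fun i => hx _⟩
  refine hS.trans ?_
  -- Disjoint blocks of `b` variables keep the `K` seeds on distinct variables.
  let B : Fin K → Finset (Fin n) := fun k =>
    Finset.univ.filter fun j : Fin n => (k : ℕ) * b ≤ j ∧ (j : ℕ) < k * b + b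
  have hBd : ∀ k k', k ≠ k' → Disjoint (B k) (B k') := by
    intro k k' hkk'
    rw [Finset.disjoint_left]
    intro j hj hj'
    have h1 := (Finset.mem_filter.1 hj).2
    have h2 := (Finset.mem_filter.1 hj').2
    refine hkk' (Fin.ext ?_)
    have h3 : ∀ k : ℕ, k * b ≤ j ∧ (j : ℕ) < k * b + b → (j : ℕ) / b = k := fun k hk =>
      Nat.div_eq_of_lt_le (by omega) (by rw [Nat.add_mul, one_mul]; omega)
    rw [← h3 k h1, ← h3 k' h2]
  have hBc : ∀ k, (B k).card = b := by
    intro k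
    have h1 : (B k).map Fin.valEmbedding = Finset.Ico ((k : ℕ) * b) (k * b + b) := by
      ext j
      simp only [B, Finset.mem_map, Finset.mem_filter, Finset.mem_univ, true_and,
        Fin.valEmbedding_apply, Finset.mem_Ico]
      constructor
      · rintro ⟨j, hj, rfl⟩
        exact hj
      · intro hj
        have : (k + 1) * b ≤ K * b := Nat.mul_le_mul_right b k.2
        rw [Nat.add_mul, one_mul] at this
        exact ⟨⟨j, by omega⟩, hj, rfl⟩
    rw [← Finset.card_map Fin.valEmbedding, h1, Nat.card_Ico]
    omega
  let hit : Bool × Fin K → Fin n → (Fin 2 → GridLiteral n q) → Prop := fun g j c =>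
    c 0 = (j, g.1, 0) ∧ (c 1).1 ∈ B g.2 ∧ (c 1).2.2 = 0
  set p : ℝ := (b : ℝ) / (2 * q ^ 2 * n ^ 2) with hp
  have hn0 : (0 : ℝ) < n := by exact_mod_cast NeZero.pos n
  have hq0 : (0 : ℝ) < q := by exact_mod_cast NeZero.pos q
  have hph : ∀ g j, prob (hit g j) = p := by
    intro g j
    rw [hp, ← hBc g.2]
    exact prob_seed_clause j g.1 (B g.2)
  have hp0 : 0 < p := by positivity
  have hprod : ∏ _g : Bool × Fin K, (1 - (1 - p) ^ M₁) = (1 - (1 - p) ^ M₁) ^ (2 * K) := by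
    simp
  have hfirst : prob (fun ω : Bool × Fin K → Fin M₁ → Fin 2 → GridLiteral n q =>
      ∀ j, ¬ ∀ g, ∃ i, hit g j (ω g i)) ≤ 1 / (n * (1 - (1 - p) ^ M₁) ^ (2 * K)) := by
    have hpos : 0 < (1 - (1 - p) ^ M₁) ^ (2 * K) := by
      rcases Nat.eq_zero_or_pos K with rfl | hK
      · simp
      · have hp1 : p ≤ 1 := by
          rw [← hph (true, ⟨0, hK⟩) 0]
          exact prob_le_one _
        refine pow_pos (sub_pos.2 (pow_lt_one₀ (by linarith) (by linarith) hM₁.ne')) _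
    have := prob_forall_not_hit_le M₁ hit (fun g j j' c hjj' h h' => hjj' (by
      have := h.1.symm.trans h'.1
      exact congrArg Prod.fst this)) (fun _ => p) hph (by
        rw [hprod, Fintype.card_fin]
        positivity)
    rwa [hprod, Fintype.card_fin] at this
  have hH2 : 0 ≤ 1 - ((H : ℝ) / (n * (2 * q))) ^ 2 := by
    have h1 : (H : ℝ) ≤ n := by exact_mod_cast (by omega : H ≤ n)
    have h2 : (1 : ℝ) ≤ 2 * q := by
      have : (3 : ℝ) ≤ q := by exact_mod_cast hq
      linarith
    have h3 : (H : ℝ) / (n * (2 * q)) ≤ 1 := by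
      rw [div_le_one (by positivity)]
      nlinarith
    have h4 : 0 ≤ (H : ℝ) / (n * (2 * q)) := by positivity
    nlinarith
  refine (prob_prod_le_add S (fun ω => ∀ j, ¬ ∀ g, ∃ i, hit g j (ω g i)) (by positivity)
    fun ω₁ hω₁ => ?_).trans (add_le_add_left hfirst _)
  push Not at hω₁
  obtain ⟨j, hj⟩ := hω₁
  obtain ⟨A, hA1, hA2, hA3, hA4⟩ := exists_seeds hq hBd ω₁ j hj
  have hfail : prob (fun F : Fin M₂ → Fin 2 → GridLiteral n q =>
      ∃ σ, Fails H H (A σ) (List.ofFn F)) ≤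
      2 * (Real.exp (-(lam * (K * (q - 2) : ℕ))) + Real.exp (C * H + μ - M₂)) := by
    refine (prob_exists_le _).trans ?_
    rw [Fintype.sum_bool, two_mul]
    have h1 : ∀ σ, prob (fun F : Fin M₂ → Fin 2 → GridLiteral n q =>
        Fails H H (A σ) (List.ofFn F)) ≤
        Real.exp (-(lam * (K * (q - 2) : ℕ))) + Real.exp (C * H + μ - M₂) := by
      intro σ
      rw [← hA3 σ]
      exact prob_fails_le hl hv₀ hC hC0 hμ hgrow hH (A σ) (hA1 σ) (hA2 σ)
    exact add_le_add (h1 _) (h1 _)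
  refine (prob_prod_le_add _ (fun F : Fin M₂ → Fin 2 → GridLiteral n q =>
    ∃ σ, Fails H H (A σ) (List.ofFn F)) (by positivity) fun F hF => ?_).trans
    (add_le_add_left hfail _)
  push Not at hF
  have hT := fun σ => exists_forced_of_not_fails H (A σ) (List.ofFn F) (hA1 σ) (hA2 σ) (hF σ)
  choose T hT1 hT2 hT3 hT4 hT5 using hT
  refine (prob_mono (T := fun F' : Fin M₃ → Fin 2 → GridLiteral n q => ∃ σ,
    ∃ x : Fin n → unitInterval, (∀ i, ∃ s, (F' i s).Holds 1 x) ∧ ∀ l ∈ T σ, l.Holds 1 x)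
    fun F' hF' => ?_).trans ((prob_exists_le _).trans ?_)
  · obtain ⟨x, hx1, hx2, hx3⟩ := hF'
    obtain ⟨σ, hσ⟩ := hA4 x hx1
    refine ⟨σ, x, hx3, hT5 σ x (fun c hc => ?_) hσ⟩
    obtain ⟨i, rfl⟩ := (List.mem_ofFn' _ _).1 hc
    exact hx2 i
  · rw [Fintype.sum_bool, two_mul]
    exact add_le_add
      (prob_no_conflicting_clause_le (T true) (hT1 _) (hT3 _) (by simpa using hT2 true) M₃)
      (prob_no_conflicting_clause_le (T false) (hT1 _) (hT3 _) (by simpa using hT2 false) M₃)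

end Seeds


/-! ### Choice of parameters for c > 2. -/

section Unsatisfiability

/-- To first order `gain` is lam · q²/2. One factor 1 - ξ pays for 1 - exp(-y) ≥ y(1 - y) with y ≤
ξ, the other for rounding, which turns q² into q(q - 3). -/
theorem le_gain {q : ℕ} (hq : 0 < q) {ξ : ℝ} (hξ0 : 0 ≤ ξ) (hξ1 : ξ ≤ 1) (hqξ : 3 / q ≤ ξ) :
    ξ / q * (1 - ξ) ^ 2 * q ^ 2 / 2 ≤ gain q (ξ / q) := by
  have hq0 : (0 : ℝ) < q := by exact_mod_cast hq
  have h1 : ∀ i : Fin q, ξ / q * (1 - ξ) * (((q - i : ℕ) : ℝ) - 2) ≤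
      1 - Real.exp (-(ξ / q * (q - 2 - i : ℕ))) := by
    intro i
    set d : ℝ := ((q - 2 - i : ℕ) : ℝ) with hd
    have hd1 : ((q - i : ℕ) : ℝ) - 2 ≤ d := by
      rw [sub_le_iff_le_add, hd]
      exact_mod_cast (by omega : q - (i : ℕ) ≤ q - 2 - i + 2)
    have hd0 : 0 ≤ d := by positivity
    have hdq : d ≤ q := by
      rw [hd]
      exact_mod_cast (by omega : q - 2 - (i : ℕ) ≤ q)
    have hy : ξ / q * d ≤ ξ := by
      calc ξ / q * d ≤ ξ / q * q := by gcongr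
        _ = ξ := by field_simp
    have hy0 : 0 ≤ ξ / q * d := by positivity
    have h2 := (abs_le.1 (Real.abs_exp_sub_one_sub_id_le (x := -(ξ / q * d))
      (by rw [abs_neg, abs_of_nonneg hy0]; linarith))).2
    have h3 : 0 ≤ ξ / q * (1 - ξ) := mul_nonneg (by positivity) (by linarith)
    calc ξ / q * (1 - ξ) * (((q - i : ℕ) : ℝ) - 2) ≤ ξ / q * (1 - ξ) * d := by gcongr
      _ = ξ / q * d * (1 - ξ) := by ring
      _ ≤ ξ / q * d * (1 - ξ / q * d) := by gcongr
      _ ≤ _ := by linarith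
  have hsum : (∑ i : Fin q, (((q - i : ℕ) : ℝ) - 2)) = q * (q - 3) / 2 := by
    have h2 : ((∑ i : Fin q, (q - i : ℕ) : ℕ) : ℝ) * 2 = q * (q + 1) := by
      exact_mod_cast sum_sub_mul_two q
    rw [Finset.sum_sub_distrib]
    push_cast at h2
    simp only [Finset.sum_const, Finset.card_univ, Fintype.card_fin, nsmul_eq_mul]
    linarith
  have hq3 : (1 - ξ) * q ≤ q - 3 := by
    rw [div_le_iff₀ hq0] at hqξ
    linarith
  calc ξ / q * (1 - ξ) ^ 2 * q ^ 2 / 2 = ξ / q * (1 - ξ) * (q * ((1 - ξ) * q) / 2) := by ring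
    _ ≤ ξ / q * (1 - ξ) * (q * (q - 3) / 2) := by
        have : 0 ≤ ξ / q * (1 - ξ) := mul_nonneg (by positivity) (by linarith)
        gcongr
    _ = ∑ i : Fin q, ξ / q * (1 - ξ) * (((q - i : ℕ) : ℝ) - 2) := by
        rw [← Finset.mul_sum, hsum]
    _ ≤ _ := Finset.sum_le_sum fun i _ => h1 i

/-- This is where the threshold 2 enters: the growth factor is about (2 + η)n/(2v) ≥ 1 + η/2. Three
losses of 1 - ξ are affordable, since with ξ = η/9 one has (1 + η/2)(1 - η/3) ≥ 1 for η ≤ 1. -/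
theorem growth_condition {q : ℕ} (hq : 0 < q) {η ξ n v H : ℝ} (hη0 : 0 < η) (hη1 : η ≤ 1)
    (hξ : ξ = η / 9) (hqξ : 3 / q ≤ ξ) (hv : 0 < v) (hvn : v ≤ n) (hH : 1 + H ≤ ξ * v) :
    ξ / q ≤ (2 + η) * n * (((v - 1 - H) / v) * (gain q (ξ / q) / (q ^ 2 * v))) := by
  have hq0 : (0 : ℝ) < q := by exact_mod_cast hq
  have hξ0 : 0 < ξ := by linarith
  have hξ1 : ξ ≤ 1 := by linarith
  have h1 : 1 - ξ ≤ (v - 1 - H) / v := by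
    rw [le_div_iff₀ hv]
    linarith
  have h2 : ξ / q * (1 - ξ) ^ 2 / (2 * v) ≤ gain q (ξ / q) / (q ^ 2 * v) := by
    rw [div_le_div_iff₀ (by positivity) (by positivity)]
    have := le_gain hq hξ0.le hξ1 hqξ
    calc ξ / q * (1 - ξ) ^ 2 * (q ^ 2 * v) = ξ / q * (1 - ξ) ^ 2 * q ^ 2 / 2 * (2 * v) := by ring
      _ ≤ _ := by gcongr
  have h3 : 1 ≤ (1 + η / 2) * (1 - ξ) ^ 3 := by
    have h4 : 1 - 3 * ξ ≤ (1 - ξ) ^ 3 := by nlinarith [mul_nonneg hξ0.le hξ0.le]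
    calc (1 : ℝ) ≤ (1 + η / 2) * (1 - 3 * ξ) := by rw [hξ]; nlinarith
      _ ≤ _ := by gcongr
  have h5 : 0 ≤ 1 - ξ := by linarith
  have h6 : 0 ≤ (v - 1 - H) / v := h5.trans h1
  have h7 : 0 ≤ (2 + η) * n := mul_nonneg (by linarith) (by linarith)
  calc ξ / q ≤ ξ / q * ((1 + η / 2) * (1 - ξ) ^ 3) := le_mul_of_one_le_right (by positivity) h3
    _ = (2 + η) * v * ((1 - ξ) * (ξ / q * (1 - ξ) ^ 2 / (2 * v))) := by
        field_simp
    _ ≤ _ := by gcongr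

/-- The expected number of hits in one seed batch is bounded below independently of `n`, so a fixed
variable is fully seeded with probability bounded below. -/
theorem one_sub_pow_seed_le {n q K b M₁ : ℕ} {η : ℝ} (hη : 0 < η) (hK : 0 < K) (hq : 0 < q)
    (hn : 0 < n) (hbn : b ≤ n) (hb : (n : ℝ) / (2 * K) ≤ b) (hM : η * n / (4 * K) ≤ M₁) :
    (1 - (b : ℝ) / (2 * q ^ 2 * n ^ 2)) ^ M₁ ≤ Real.exp (-(η / (16 * K ^ 2 * q ^ 2))) := by
  have hK0 : (0 : ℝ) < K := by exact_mod_cast hK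
  have hq0 : (1 : ℝ) ≤ q := by exact_mod_cast hq
  have hn0 : (1 : ℝ) ≤ n := by exact_mod_cast hn
  have hbn' : (b : ℝ) ≤ n := by exact_mod_cast hbn
  set p : ℝ := (b : ℝ) / (2 * q ^ 2 * n ^ 2) with hp
  have hp1 : p ≤ 1 := by
    rw [hp, div_le_one (by positivity)]
    have h1 : (n : ℝ) ≤ n ^ 2 := by nlinarith
    have h2 : (1 : ℝ) ≤ q ^ 2 := by nlinarith
    nlinarith
  have h1 : 1 - p ≤ Real.exp (-p) := by
    have := Real.add_one_le_exp (-p)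
    linarith
  calc (1 - p) ^ M₁ ≤ Real.exp (-p) ^ M₁ := by
        gcongr
    _ = Real.exp (-(M₁ * p)) := by
        rw [← Real.exp_nat_mul, mul_neg]
    _ ≤ _ := by
        gcongr
        calc η / (16 * K ^ 2 * q ^ 2) = η * n / (4 * K) * ((n : ℝ) / (2 * K) / (2 * q ^ 2 * n ^ 2)) := by
              field_simp
              norm_num
          _ ≤ M₁ * p := by
              rw [hp]
              gcongr

set_option maxHeartbeats 400000 in
theorem exists_grid_eventually_le {η ε : ℝ} (hη0 : 0 < η) (hη1 : η ≤ 1) (hε : 0 < ε) :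
    ∃ q : ℕ, 0 < q ∧ ∀ᶠ n : ℕ in atTop, ∀ m : ℕ, (2 + 4 * η) * n ≤ m →
      prob (fun G : GridFormula n q m => GridSat 1 G) ≤ ε := by
  obtain ⟨ξ, hξ⟩ : ∃ ξ : ℝ, ξ = η / 9 := ⟨_, rfl⟩
  have hξ0 : 0 < ξ := by linarith
  obtain ⟨q, hq⟩ := exists_nat_ge (max 3 (3 / ξ))
  have hq3 : 3 ≤ q := by exact_mod_cast (le_max_left _ _).trans hq
  have hq0 : (0 : ℝ) < q := by positivity
  have hqξ : 3 / (q : ℝ) ≤ ξ := by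
    rw [div_le_iff₀ hq0]
    have := (le_max_right _ _).trans hq
    rw [div_le_iff₀ hξ0] at this
    linarith
  have : NeZero q := ⟨by omega⟩
  refine ⟨q, by omega, ?_⟩
  set lam : ℝ := ξ / q with hlam
  have hlam0 : 0 < lam := by positivity
  obtain ⟨K, hK0, hK⟩ : ∃ K : ℕ, 0 < K ∧ Real.exp (-(lam * (K * (q - 2) : ℕ))) ≤ ε / 8 := by
    have h1 : Tendsto (fun K : ℕ => Real.exp (-(lam * K))) atTop (𝓝 0) :=
      Real.tendsto_exp_neg_atTop_nhds_zero.comp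
        (tendsto_natCast_atTop_atTop.const_mul_atTop hlam0)
    obtain ⟨K, hK, hK0⟩ := ((h1.eventually_le_const (show 0 < ε / 8 by linarith)).and
      (eventually_gt_atTop 0)).exists
    refine ⟨K, hK0, le_trans ?_ hK⟩
    gcongr
    exact Nat.le_mul_of_pos_right K (by omega)
  have hK0' : (0 : ℝ) < K := by exact_mod_cast hK0
  set β : ℝ := η / (16 * K ^ 2 * q ^ 2) with hβ
  have hβ0 : 0 < β := by positivity
  have hπ : 0 < (1 - Real.exp (-β)) ^ (2 * K) := by
    refine pow_pos (sub_pos.2 ?_) _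
    rw [Real.exp_lt_one_iff]
    linarith
  have hcast : Tendsto (fun n : ℕ => (n : ℝ)) atTop atTop := tendsto_natCast_atTop_atTop
  have hlim1 : Tendsto (fun n : ℕ => 1 / ((n : ℝ) * (1 - Real.exp (-β)) ^ (2 * K))) atTop (𝓝 0) := by
    simp only [one_div]
    exact (hcast.atTop_mul_const hπ).inv_tendsto_atTop
  have hlim2 : Tendsto (fun n : ℕ => Real.exp (-(η / 2 * n))) atTop (𝓝 0) :=
    Real.tendsto_exp_neg_atTop_nhds_zero.comp (hcast.const_mul_atTop (by positivity))
  -- Chosen so that 60H ≤ ηn/2, half of the surplus ηn of `M₂` over (2 + η)n.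
  set δ : ℝ := η / 120 with hδ
  have hδ0 : 0 < δ := by positivity
  have hbase : (δ / (4 * q)) ^ 2 < 1 ∧ 0 < (δ / (4 * q)) ^ 2 := by
    refine ⟨?_, by positivity⟩
    have h1 : δ / (4 * q) < 1 := by
      rw [div_lt_one (by positivity)]
      have : (3 : ℝ) ≤ q := by exact_mod_cast hq3
      linarith
    have h2 : 0 < δ / (4 * q) := by positivity
    nlinarith
  have hlim3 : Tendsto (fun n : ℕ => (1 - (δ / (4 * q)) ^ 2) ^ ⌊η / 2 * n⌋₊) atTop (𝓝 0) :=
    (tendsto_pow_atTop_nhds_zero_of_lt_one (by linarith [hbase.1]) (by linarith [hbase.2])).comp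
      (tendsto_nat_floor_atTop.comp (hcast.const_mul_atTop (by positivity)))
  filter_upwards [hlim1.eventually_le_const (show 0 < ε / 4 by linarith),
    hlim2.eventually_le_const (show 0 < ε / 8 by linarith),
    hlim3.eventually_le_const (show 0 < ε / 8 by linarith),
    hcast.eventually_ge_atTop (360 / η), hcast.eventually_ge_atTop (4 * K / η),
    eventually_ge_atTop (2 * K), eventually_ge_atTop 3] with n h1 h2 h3 h4 h5 h6 h7 m hm
  have : NeZero n := ⟨by omega⟩
  have hn0 : (0 : ℝ) < n := by positivity
  rw [div_le_iff₀ hη0] at h4 h5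
  set H : ℕ := ⌊δ * n⌋₊ with hH
  have hH1 : (H : ℝ) ≤ δ * n := Nat.floor_le (by positivity)
  have hH2 : δ * n - 1 < H := Nat.sub_one_lt_floor _
  set M₁ : ℕ := ⌊η * n / (2 * K)⌋₊ with hM₁
  have hM₁1 : (M₁ : ℝ) ≤ η * n / (2 * K) := Nat.floor_le (by positivity)
  have hM₁2 : η * n / (2 * K) - 1 < M₁ := Nat.sub_one_lt_floor _
  set M₂ : ℕ := ⌈(2 + 2 * η) * n⌉₊ with hM₂
  have hM₂1 : (2 + 2 * η) * n ≤ M₂ := Nat.le_ceil _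
  have hM₂2 : (M₂ : ℝ) < (2 + 2 * η) * n + 1 := Nat.ceil_lt_add_one (by positivity)
  set M₃ : ℕ := ⌊η / 2 * n⌋₊ with hM₃
  have hM₃1 : (M₃ : ℝ) ≤ η / 2 * n := Nat.floor_le (by positivity)
  have hv₀ : (n : ℝ) ≤ 3 * (n / 2 : ℕ) := by exact_mod_cast (by omega : n ≤ 3 * (n / 2))
  have hv₀' : 2 * ((n / 2 : ℕ) : ℝ) ≤ n := by exact_mod_cast (by omega : 2 * (n / 2) ≤ n)
  have hηn : η * n ≤ n := mul_le_of_le_one_left hn0.le hη1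
  have hM₁4 : η * n / (4 * K) ≤ M₁ := by
    have h8 : 1 ≤ η * n / (4 * K) := by
      rw [le_div_iff₀ (by positivity)]
      linarith
    have h9 : η * n / (2 * K) = η * n / (4 * K) + η * n / (4 * K) := by field_simp; norm_num
    linarith
  have hb : (n : ℝ) / (2 * K) ≤ (n / K : ℕ) := by
    rw [div_le_iff₀ (by positivity)]
    have h8 : n < (n / K + 1) * K := Nat.lt_mul_of_div_lt (Nat.lt_succ_self _) hK0
    have h9 : K ≤ n / K * K := Nat.le_mul_of_pos_left K (Nat.div_pos (by omega) hK0)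
    have h10 : n ≤ n / K * (2 * K) := by nlinarith
    exact_mod_cast h10
  -- C = 60 works because M₂ ≤ 4n + 1 and n/2, rounded down, is at least n/3. The batches use at
  -- most ηn, (2 + 2η)n + 1 and ηn/2 clauses, together at most (2 + 4η)n.
  have hmain := prob_gridSat_le (n := n) hq3 hlam0.le (m := m) (K := K) (M₁ := M₁) (M₂ := M₂)
    (M₃ := M₃) (H := H) (v₀ := n / 2) (b := n / K) (C := 60) (μ := (2 + η) * n)
    (by
      have h8 : (2 * K : ℝ) * M₁ ≤ η * n := by
        calc (2 * K : ℝ) * M₁ ≤ 2 * K * (η * n / (2 * K)) := by gcongr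
          _ = η * n := by field_simp
      have h9 : ((2 * K * M₁ + M₂ + M₃ : ℕ) : ℝ) ≤ m := by
        push_cast
        linarith
      exact_mod_cast h9)
    (Nat.mul_div_le n K) (Nat.div_pos (by omega) hK0)
    (by
      have : (0 : ℝ) < M₁ := lt_of_lt_of_le (by positivity) hM₁4
      exact_mod_cast this)
    (by omega)
    (by linarith)
    (by norm_num) (by positivity)
    (fun v hv hvn => by
      have hv1 : ((n / 2 : ℕ) : ℝ) ≤ v := by exact_mod_cast hv
      have hv2 : (v : ℝ) ≤ n := by exact_mod_cast hvn
      refine growth_condition (by omega) hη0 hη1 hξ hqξ (by linarith) hv2 ?_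
      have hv3 : η * n ≤ η * (3 * v) := by
        gcongr
        linarith
      rw [hξ]
      rw [hδ] at hH1
      linarith)
    (by
      have h8 : ((n / 2 + H : ℕ) : ℝ) ≤ n := by
        rw [Nat.cast_add]
        rw [hδ] at hH1
        linarith
      exact_mod_cast h8)
  refine hmain.trans ?_
  have t1 : 1 / (n * (1 - (1 - ((n / K : ℕ) : ℝ) / (2 * q ^ 2 * n ^ 2)) ^ M₁) ^ (2 * K)) ≤ ε / 4 := by
    refine le_trans ?_ h1
    have h8 := one_sub_pow_seed_le (n := n) (q := q) (b := n / K) hη0 hK0 (by omega) (by omega)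
      (Nat.div_le_self n K) hb hM₁4
    have h9 : 0 ≤ 1 - Real.exp (-β) := by
      rw [sub_nonneg, Real.exp_le_one_iff]
      linarith
    gcongr
  have t2 : Real.exp (60 * H + (2 + η) * n - M₂) ≤ ε / 8 := by
    refine le_trans (Real.exp_le_exp.2 ?_) h2
    rw [hδ] at hH1
    linarith
  have t3 : (1 - ((H : ℝ) / (n * (2 * q))) ^ 2) ^ M₃ ≤ ε / 8 := by
    refine le_trans ?_ h3
    have h8 : δ / (4 * q) ≤ (H : ℝ) / (n * (2 * q)) := by
      rw [div_le_div_iff₀ (by positivity) (by positivity)]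
      have : δ * n ≤ 2 * H := by
        have : 2 ≤ δ * n := by rw [hδ]; linarith
        linarith
      calc δ * (n * (2 * q)) = δ * n * (2 * q) := by ring
        _ ≤ 2 * H * (2 * q) := by gcongr
        _ = H * (4 * q) := by ring
    have h10 : (H : ℝ) / (n * (2 * q)) ≤ 1 := by
      rw [div_le_one (by positivity)]
      have : (1 : ℝ) ≤ 2 * q := by
        have : (3 : ℝ) ≤ q := by exact_mod_cast hq3
        linarith
      have hHn : (H : ℝ) ≤ n := by
        rw [hδ] at hH1
        linarith
      exact hHn.trans (le_mul_of_one_le_right hn0.le this)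
    have h11 : 0 ≤ (H : ℝ) / (n * (2 * q)) := by positivity
    have h12 : ((H : ℝ) / (n * (2 * q))) ^ 2 ≤ 1 := pow_le_one₀ h11 h10
    gcongr
  linarith

theorem tendsto_formulaLawRep_sat {c : ℝ} (hc : 2 < c) {m : ℕ → ℕ}
    (hm : Tendsto (fun n : ℕ => (m n : ℝ) / (n : ℝ)) atTop (𝓝 c)) :
    Tendsto (fun n => formulaLawRep 2 n (m n) {F | F.Satisfiable}) atTop (𝓝 0) := by
  rw [ENNReal.tendsto_nhds_zero]
  intro ε hε
  obtain ⟨ε', hε', hεε'⟩ : ∃ ε' : ℝ, 0 < ε' ∧ ENNReal.ofReal ε' ≤ ε := by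
    obtain ⟨r, hr0, hr⟩ := ENNReal.lt_iff_exists_nnreal_btwn.1 hε
    refine ⟨r, by exact_mod_cast hr0, ?_⟩
    rw [ENNReal.ofReal_coe_nnreal]
    exact hr.le
  have hη0 : 0 < min 1 ((c - 2) / 5) := lt_min one_pos (by linarith)
  set η : ℝ := min 1 ((c - 2) / 5) with hη
  have hηc : 2 + 4 * η < c := by
    have := min_le_right 1 ((c - 2) / 5)
    linarith
  obtain ⟨q, hq, h⟩ := exists_grid_eventually_le hη0 (min_le_left _ _) hε'
  have : NeZero q := ⟨hq.ne'⟩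
  filter_upwards [h, hm.eventually_const_le hηc, eventually_ge_atTop 1] with n hn hmn hn1
  have : NeZero n := ⟨by omega⟩
  have hn0 : (0 : ℝ) < n := by exact_mod_cast hn1
  rw [le_div_iff₀ hn0] at hmn
  refine le_trans (measure_mono ?_) ((formulaLawRep_toGrid_le (q := q)
    (fun G => GridSat 1 G)).trans ((ENNReal.ofReal_le_ofReal (hn _ hmn)).trans hεε'))
  rintro F ⟨x, hx⟩
  refine ⟨x, fun i => ?_⟩
  obtain ⟨s, hs⟩ := hx i
  exact ⟨s, toGrid_holds_of_holds hs⟩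

end Unsatisfiability

end RegularSAT

theorem theorem2 (c : ℝ) (m : ℕ → ℕ)
    (hm : Tendsto (fun n : ℕ => (m n : ℝ) / (n : ℝ)) atTop (𝓝 c)) :
    (c < 2 →
      Tendsto (fun n : ℕ => RegularSAT.formulaLaw 2 n (m n) {F | F.Satisfiable}) atTop (𝓝 1) ∧
      Tendsto (fun n : ℕ => RegularSAT.formulaLawRep 2 n (m n) {F | F.Satisfiable}) atTop (𝓝 1)) ∧
    (2 < c →
      Tendsto (fun n : ℕ => RegularSAT.formulaLaw 2 n (m n) {F | F.Satisfiable}) atTop (𝓝 0) ∧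
      Tendsto (fun n : ℕ => RegularSAT.formulaLawRep 2 n (m n) {F | F.Satisfiable}) atTop (𝓝 0)) := by
  refine ⟨fun hc => ?_, fun hc => ?_⟩
  · have h := RegularSAT.tendsto_formulaLawRep_unsat hc hm
    refine ⟨RegularSAT.tendsto_measure_one _ ?_ _ (RegularSAT.tendsto_formulaLaw_zero hm _ h),
      RegularSAT.tendsto_measure_one _ ?_ _ h⟩
    · filter_upwards [eventually_ge_atTop 2] with n hn
      exact RegularSAT.isProbabilityMeasure_formulaLaw n (m n) hn
    · filter_upwards [eventually_ge_atTop 1] with n hn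
      have : NeZero n := ⟨by omega⟩
      infer_instance
  · have h := RegularSAT.tendsto_formulaLawRep_sat hc hm
    exact ⟨RegularSAT.tendsto_formulaLaw_zero hm _ h, h⟩
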